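/- Write $\mathbb{D}^2$ for the open unit bidisk and $\mathbb{T}^2$ for the 2-torus in $\mathbb{C}^2$. For $p\in\mathbb{C}[z_1,z_2]$ of bidegree $(m,n)$ let $\tilde p(z_1,z_2)=z_1^m z_2^n\,\overline{p(1/\bar z_1,1/\bar z_2)}$. A normalized rational inner function (RIF) is a function $\phi=e^{i\alpha}\tilde p/p$, where $\alpha\in\mathbb{R}$, $p$ has no zeros in $\mathbb{D}^2$, and $p$ and $\tilde p$ have no common factor. For a pair $\Phi=(q_1/p_1,q_2/p_2)$ of rational functions in lowest terms put $P_j=q_j-z_jp_j$ and let $\Gamma(\Phi)=\{z\in\overline{\mathbb{D}^2}: P_1(z)=P_2(z)=0\}$. **Proposition.** Let $\Phi=(z_1\phi,z_2)$, where $\phi$ is a normalized RIF that is not identically $1$. (So $P_1=z_1(e^{i\alpha}\tilde p-p)$ and $P_2=0$.) Then $\Gamma(\Phi)\cap\mathbb{T}^2$ is the union of a finite family of closed curves, any two distinct ones of which meet in at most finitely many points, and each of these component curves can be parametrized by analytic functions. More precisely, each of them is either a fiber $\{(e^{is},\lambda): s\in\mathbb{R}\}$ with $\lambda\in\mathbb{T}$,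 or a curve $\{(e^{i\theta(t)},e^{it}): t\in\mathbb{R}\}$ over the fiber variable $z_2=e^{it}$, where $\theta:\mathbb{R}\to\mathbb{R}$ is real analytic and $\theta(t+2\pi k)=\theta(t)+2\pi m$ for all $t$, for some integers $k\ge 1$ and $m$. -/

import Mathlib

open MvPolynomial

noncomputable section

namespace RIF

/-- Points `(z₁, z₂)` of `ℂ²`; the first coordinate has index `0`, the second index `1`. -/
abbrev C2 : Type := Fin 2 → ℂ

/-- Polynomials in two complex variables. -/
abbrev Poly2 : Type := MvPolynomial (Fin 2) ℂ

/-- The open unit bidisk. -/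
def bidisk : Set C2 := {z | ∀ i, ‖z i‖ < 1}

/-- The closed unit bidisk. -/
def closedBidisk : Set C2 := {z | ∀ i, ‖z i‖ ≤ 1}

/-- The 2-torus. -/
def torus : Set C2 := {z | ∀ i, ‖z i‖ = 1}

/-- The zero set of a polynomial in `ℂ²`. -/
def zeroSet (P : Poly2) : Set C2 := {z | eval z P = 0}

/-- The bidegree of `p`, as an exponent vector. -/
def bidegree (p : Poly2) : Fin 2 →₀ ℕ :=
  Finsupp.equivFunOnFinite.symm fun i => p.degreeOf i

/-- The reflection of `p`: if `p = ∑ a_s z^s` has bidegree `n`, this is `∑ conj(a_s) z^(n - s)`. -/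
def reflection (p : Poly2) : Poly2 :=
  ∑ s ∈ p.support, monomial (bidegree p - s) (starRingEnd ℂ (coeff s p))

/-- The reflection satisfies `z₁^m z₂^n * conj (p (1 / conj z₁, 1 / conj z₂))`
off the coordinate axes, where `(m, n)` is the bidegree of `p`. -/
theorem eval_reflection (p : Poly2) (z : C2) (hz : ∀ i, z i ≠ 0) :
    eval z (reflection p) =
      z 0 ^ p.degreeOf 0 * z 1 ^ p.degreeOf 1 *
        starRingEnd ℂ (eval (fun i => 1 / starRingEnd ℂ (z i)) p) := by
  have key : ∀ s ∈ p.support, ∀ i, s i ≤ p.degreeOf i := fun s hs i =>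
    monomial_le_degreeOf i hs
  rw [reflection, map_sum, eval_eq', map_sum, Finset.mul_sum]
  refine Finset.sum_congr rfl fun s hs => ?_
  rw [eval_monomial, Finsupp.prod_fintype _ _ (by simp)]
  simp only [Fin.prod_univ_two, map_mul, map_pow, map_div₀, map_one, Complex.conj_conj,
    bidegree, Finsupp.tsub_apply, Finsupp.equivFunOnFinite_symm_apply_apply]
  rw [pow_sub₀ _ (hz 0) (key s hs 0), pow_sub₀ _ (hz 1) (key s hs 1)]
  simp only [one_div, inv_pow]
  ring

/-- A normalized rational inner function `φ = e^{iα} p̃ / p` on the bidisk: `p` has no zeros in the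
bidisk and is atoral, that is, `p` and its reflection `p̃` have no common factors. -/
structure NormalizedRIF where
  /-- the denominator `p` -/
  den : Poly2
  /-- the angle `α` of the unimodular factor -/
  angle : ℝ
  den_ne_zero : ∀ z ∈ bidisk, eval z den ≠ 0
  atoral : IsRelPrime den (reflection den)

namespace NormalizedRIF

/-- The numerator `e^{iα} p̃`. -/
def num (φ : NormalizedRIF) : Poly2 :=
  C (Complex.exp (φ.angle * Complex.I)) * reflection φ.den

/-- The value `φ(z) = e^{iα} p̃(z) / p(z)`, meaningful off the zeros of `p`. -/
def toFun (φ : NormalizedRIF) (z : C2) : ℂ := eval z φ.num / eval z φ.den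

end NormalizedRIF

/-- A pair of rational functions `Φ = (φ₁, φ₂)`, given by numerators and denominators in lowest
terms. -/
structure RationalMap where
  /-- the numerators -/
  num : Fin 2 → Poly2
  /-- the denominators -/
  den : Fin 2 → Poly2
  coprime : ∀ j, IsRelPrime (num j) (den j)

namespace RationalMap

/-- The polynomial `P_j = (numerator of φ_j) - z_j * (denominator of φ_j)`. -/
def fixedPointPoly (Φ : RationalMap) (j : Fin 2) : Poly2 := Φ.num j - X j * Φ.den j

/-- `Γ(Φ)`: the common zeros of `P₁` and `P₂` in the closed bidisk. -/
def Gamma (Φ : RationalMap) : Set C2 :=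
  zeroSet (Φ.fixedPointPoly 0) ∩ zeroSet (Φ.fixedPointPoly 1) ∩ closedBidisk

end RationalMap

/-- A polynomial without zeros in the bidisk has no common factor with `z₁`. -/
theorem isRelPrime_X_zero {p : Poly2} (hp : ∀ z ∈ bidisk, eval z p ≠ 0) :
    IsRelPrime (X 0 : Poly2) p := by
  refine (Irreducible.isRelPrime_iff_not_dvd (MvPolynomial.X_prime (i := 0)).irreducible).2 ?_
  rintro ⟨q, rfl⟩
  exact hp 0 (fun i => by simp) (by simp)

/-- The map `Φ = (z₁ φ, z₂)`. -/
def NormalizedRIF.twistedMap (φ : NormalizedRIF) : RationalMap where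
  num := ![X 0 * φ.num, X 1]
  den := ![φ.den, 1]
  coprime := by
    intro j
    fin_cases j
    · refine IsRelPrime.mul_left (isRelPrime_X_zero φ.den_ne_zero) ?_
      refine IsRelPrime.mul_left ?_ φ.atoral.symm
      exact IsUnit.isRelPrime_left ((Complex.exp_ne_zero _).isUnit.map C)
    · exact isRelPrime_one_right

/-- The point `(e^{is}, e^{it})` of the 2-torus. -/
def torusPoint (s t : ℝ) : C2 := ![Complex.exp (s * Complex.I), Complex.exp (t * Complex.I)]

/-- A closed analytic curve in the 2-torus that is parametrized by the fiber variable `z₂ = e^{it}`: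
it is `t ↦ (e^{iθ(t)}, e^{it})` with `θ` real analytic on `ℝ`, and it closes up after `k ≥ 1`
turns of `z₂`. -/
def IsClosedAnalyticGraph (K : Set C2) : Prop :=
  ∃ θ : ℝ → ℝ, AnalyticOnNhd ℝ θ Set.univ ∧
    (∃ k : ℕ, 0 < k ∧ ∃ m : ℤ, ∀ t, θ (t + 2 * Real.pi * k) = θ t + 2 * Real.pi * m) ∧
    K = Set.range fun t : ℝ => torusPoint (θ t) t

/-- A fiber `{z ∈ 𝕋² : z₂ = e^{it}}` of the 2-torus, that is the closed analytic curve
`s ↦ (e^{is}, e^{it})`. -/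
def IsTorusFiber (K : Set C2) : Prop :=
  ∃ t : ℝ, K = Set.range fun s : ℝ => torusPoint s t

end RIF

end

/-! On the torus `z₁ ≠ 0`, so the set in question is the zero set there of `F = e^{iα} p̃ - p`
(`levelPoly`). The maximum principle gives `|p̃| ≤ |p|` on the bidisk (`norm_reflection_le`). Since
`φ` is not identically `1`, the strong maximum principle then shows that `F` has no zeros in the
bidisk (`toFun_ne_one`).

Fix `w` on the unit circle. By a Hurwitz argument, `F(·, w)` has no zero in the open disk unless it
vanishes identically (`slice_eq_zero_of_root`). Up to a unimodular factor `F` is its own reflection,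
so zeros outside the closed disk are excluded in the same way. Hence every slice over the circle
vanishes identically or has all its zeros on the circle (`slice_levelPoly`). The vanishing slices
are finite in number and give the fibers.

For the remaining curves, divide `F(·, e^{it})` by its leading coefficient. The roots have modulus
`1`, so the coefficients of the quotient are bounded and extend analytically across the zeros of the
leading coefficient. A Cayley transform moves the roots to the real line, where Rellich's theorem
(`hasAnalyticRoots`) supplies analytic roots; this yields local angle functions `θ`
(`exists_local_branches`).

Local branches continue along the whole real line (`HasLocalBranches.exists_extension_univ`). Modulo
`2π` there are finitely many global branches, so the pigeonhole principle applied to translates by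
`2πn` closes each of them up (`exists_period`). The identity theorem makes two curves with
infinitely many common points equal (`graphCurve_eq_of_infinite_inter`). -/

noncomputable section

namespace RIF

open Filter Topology Set
open scoped Polynomial

/-! ### Monic polynomials with analytic coefficients -/

/-- The monic polynomial of degree `a` whose lower coefficients are the entries of `u`. -/
def monicOfFn (a : ℕ) (u : Fin a → ℂ) : ℂ[X] := Polynomial.X ^ a + Polynomial.ofFn a u

theorem monicOfFn_monic (a : ℕ) (u : Fin a → ℂ) : (monicOfFn a u).Monic :=
  Polynomial.monic_X_pow_add (Polynomial.ofFn_degree_lt u)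

theorem natDegree_monicOfFn (a : ℕ) (u : Fin a → ℂ) : (monicOfFn a u).natDegree = a := by
  refine Polynomial.natDegree_eq_of_degree_eq_some ?_
  rw [monicOfFn, Polynomial.degree_add_eq_left_of_degree_lt, Polynomial.degree_X_pow]
  rw [Polynomial.degree_X_pow]
  exact Polynomial.ofFn_degree_lt u

theorem coeff_monicOfFn (a : ℕ) (u : Fin a → ℂ) (i : Fin a) : (monicOfFn a u).coeff i = u i := by
  rw [monicOfFn, Polynomial.coeff_add, Polynomial.coeff_X_pow, if_neg i.2.ne, zero_add,
    Polynomial.ofFn_coeff_eq_val_of_lt u i.2]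

theorem monic_ext {P Q : ℂ[X]} {n : ℕ} (hP : P.Monic) (hQ : Q.Monic) (hPn : P.natDegree = n)
    (hQn : Q.natDegree = n) (h : ∀ i < n, P.coeff i = Q.coeff i) : P = Q := by
  ext i
  rcases lt_trichotomy i n with hi | rfl | hi
  · exact h i hi
  · rw [← hPn, hP.coeff_natDegree, hPn, ← hQn, hQ.coeff_natDegree]
  · rw [Polynomial.coeff_eq_zero_of_natDegree_lt (hPn ▸ hi),
      Polynomial.coeff_eq_zero_of_natDegree_lt (hQn ▸ hi)]

theorem monicOfFn_coeff {P : ℂ[X]} {n : ℕ} (hP : P.Monic) (hPn : P.natDegree = n) :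
    monicOfFn n (fun i => P.coeff i) = P :=
  monic_ext (monicOfFn_monic _ _) hP (natDegree_monicOfFn _ _) hPn fun i hi =>
    coeff_monicOfFn n _ ⟨i, hi⟩

/-- The family of polynomials `P` has coefficients that are analytic at `t₀`. -/
def AnalyticCoeffs {E : Type*} [NormedAddCommGroup E] {𝕜 : Type*} [NontriviallyNormedField 𝕜]
    [NormedSpace 𝕜 E] [NormedAlgebra 𝕜 ℂ] (P : E → ℂ[X]) (t₀ : E) : Prop :=
  ∀ k, AnalyticAt 𝕜 (fun t => (P t).coeff k) t₀

section
variable {E : Type*} [NormedAddCommGroup E] {𝕜 : Type*} [NontriviallyNormedField 𝕜]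
    [NormedSpace 𝕜 E] [NormedAlgebra 𝕜 ℂ] {P Q : E → ℂ[X]} {t₀ : E}

theorem AnalyticCoeffs.mul (hP : AnalyticCoeffs (𝕜 := 𝕜) P t₀) (hQ : AnalyticCoeffs (𝕜 := 𝕜) Q t₀) :
    AnalyticCoeffs (𝕜 := 𝕜) (fun t => P t * Q t) t₀ := by
  intro k
  simp only [Polynomial.coeff_mul]
  exact Finset.analyticAt_fun_sum _ fun i _ => (hP _).mul (hQ _)

theorem AnalyticCoeffs.add (hP : AnalyticCoeffs (𝕜 := 𝕜) P t₀) (hQ : AnalyticCoeffs (𝕜 := 𝕜) Q t₀) :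
    AnalyticCoeffs (𝕜 := 𝕜) (fun t => P t + Q t) t₀ := by
  intro k
  simp only [Polynomial.coeff_add]
  exact (hP _).add (hQ _)

theorem analyticCoeffs_const (p : ℂ[X]) : AnalyticCoeffs (𝕜 := 𝕜) (fun _ : E => p) t₀ :=
  fun _ => analyticAt_const

theorem analyticCoeffs_C {f : E → ℂ} (hf : AnalyticAt 𝕜 f t₀) :
    AnalyticCoeffs (𝕜 := 𝕜) (fun t => Polynomial.C (f t)) t₀ := by
  intro k
  simp only [Polynomial.coeff_C]
  split_ifs
  exacts [hf, analyticAt_const]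

theorem AnalyticCoeffs.pow (hP : AnalyticCoeffs (𝕜 := 𝕜) P t₀) (n : ℕ) :
    AnalyticCoeffs (𝕜 := 𝕜) (fun t => P t ^ n) t₀ := by
  induction n with
  | zero => simpa using analyticCoeffs_const 1
  | succ n ih => simpa only [pow_succ] using ih.mul hP

theorem analyticCoeffs_sum {ι : Type*} (s : Finset ι) {P : ι → E → ℂ[X]}
    (hP : ∀ i ∈ s, AnalyticCoeffs (𝕜 := 𝕜) (P i) t₀) :
    AnalyticCoeffs (𝕜 := 𝕜) (fun t => ∑ i ∈ s, P i t) t₀ := by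
  intro k
  simp only [Polynomial.finsetSum_coeff]
  exact Finset.analyticAt_fun_sum _ fun i hi => hP i hi k

theorem analyticCoeffs_monicOfFn (n : ℕ) {c : E → Fin n → ℂ} (hc : ∀ i, AnalyticAt 𝕜 (c · i) t₀) :
    AnalyticCoeffs (𝕜 := 𝕜) (fun t => monicOfFn n (c t)) t₀ := by
  refine (analyticCoeffs_const _).add fun k => ?_
  rcases lt_or_ge k n with hk | hk
  · simp only [Polynomial.ofFn_coeff_eq_val_of_lt _ hk]
    exact hc _
  · simp only [Polynomial.ofFn_coeff_eq_zero_of_ge _ hk]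
    exact analyticAt_const

end

/-! ### Analytic continuation of coprime factorizations -/

/-- Multiplication of monic polynomials, in terms of their lower coefficients. -/
def mulCoeffs (a b : ℕ) (w : (Fin a → ℂ) × (Fin b → ℂ)) : Fin (a + b) → ℂ :=
  fun k => (monicOfFn a w.1 * monicOfFn b w.2).coeff k

theorem analyticAt_mulCoeffs (a b : ℕ) (w : (Fin a → ℂ) × (Fin b → ℂ)) :
    AnalyticAt ℂ (mulCoeffs a b) w := by
  refine AnalyticAt.pi fun k => ?_
  refine (AnalyticCoeffs.mul (𝕜 := ℂ) (P := fun w : (Fin a → ℂ) × (Fin b → ℂ) => monicOfFn a w.1)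
    (Q := fun w => monicOfFn b w.2) ?_ ?_) k
  · refine analyticCoeffs_monicOfFn a fun i => ?_
    exact ((ContinuousLinearMap.proj (R := ℂ) (φ := fun _ : Fin a => ℂ) i).comp
      (ContinuousLinearMap.fst ℂ _ (Fin b → ℂ))).analyticAt w
  · refine analyticCoeffs_monicOfFn b fun i => ?_
    exact ((ContinuousLinearMap.proj (R := ℂ) (φ := fun _ : Fin b => ℂ) i).comp
      (ContinuousLinearMap.snd ℂ (Fin a → ℂ) _)).analyticAt w

/-- Along the line `w + s • h` the product is `(p + sU)(q + sV)`, quadratic in `s`; the derivative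
is its linear term. -/
theorem fderiv_mulCoeffs_apply (a b : ℕ) (w h : (Fin a → ℂ) × (Fin b → ℂ)) (k : Fin (a + b)) :
    fderiv ℂ (mulCoeffs a b) w h k =
      (Polynomial.ofFn a h.1 * monicOfFn b w.2 + monicOfFn a w.1 * Polynomial.ofFn b h.2).coeff k := by
  have h1 : HasDerivAt (fun s : ℂ => w + s • h) h 0 := by
    simpa using ((hasDerivAt_id (0 : ℂ)).smul_const h).const_add w
  have h2 : HasFDerivAt (mulCoeffs a b) (fderiv ℂ (mulCoeffs a b) w) (w + (0 : ℂ) • h) := by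
    simpa using (analyticAt_mulCoeffs a b w).differentiableAt.hasFDerivAt
  have h3 := hasDerivAt_pi.1 (h2.comp_hasDerivAt (0 : ℂ) h1) k
  refine h3.unique ?_
  set p := monicOfFn a w.1
  set q := monicOfFn b w.2
  set U := Polynomial.ofFn a h.1
  set V := Polynomial.ofFn b h.2
  have h4 : ∀ s : ℂ, mulCoeffs a b (w + s • h) k =
      (p * q).coeff k + s * (U * q + p * V).coeff k + s ^ 2 * (U * V).coeff k := by
    intro s
    have e1 : monicOfFn a (w + s • h).1 = p + Polynomial.C s * U := by
      simp [monicOfFn, p, U, Polynomial.smul_eq_C_mul, add_assoc]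
    have e2 : monicOfFn b (w + s • h).2 = q + Polynomial.C s * V := by
      simp [monicOfFn, q, V, Polynomial.smul_eq_C_mul, add_assoc]
    have e3 : (p + Polynomial.C s * U) * (q + Polynomial.C s * V) =
        p * q + Polynomial.C s * (U * q + p * V) + Polynomial.C (s ^ 2) * (U * V) := by
      rw [Polynomial.C_pow]; ring
    rw [mulCoeffs, e1, e2, e3]
    simp only [Polynomial.coeff_add, Polynomial.coeff_C_mul]
  have h5 : HasDerivAt (fun s : ℂ =>
      (p * q).coeff k + s * (U * q + p * V).coeff k + s ^ 2 * (U * V).coeff k)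
      ((U * q + p * V).coeff k) 0 := by
    have := (((hasDerivAt_id (0 : ℂ)).mul_const ((U * q + p * V).coeff k)).const_add
      ((p * q).coeff k)).fun_add (((hasDerivAt_id (0 : ℂ)).pow 2).mul_const ((U * V).coeff k))
    simpa using this
  exact h5.congr_of_eventuallyEq (Eventually.of_forall h4)

/-- If `Uq + pV = 0` with `p`, `q` coprime, then `p` divides `U`, and `deg U < deg p` forces `U =
0`, whence `V = 0`. -/
theorem fderiv_mulCoeffs_injective {a b : ℕ} {w : (Fin a → ℂ) × (Fin b → ℂ)}
    (hw : IsCoprime (monicOfFn a w.1) (monicOfFn b w.2)) :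
    Function.Injective (fderiv ℂ (mulCoeffs a b) w) := by
  rw [injective_iff_map_eq_zero]
  intro h hh
  have hU := Polynomial.ofFn_degree_lt h.1
  have hV := Polynomial.ofFn_degree_lt h.2
  have hp := monicOfFn_monic a w.1
  have hq := monicOfFn_monic b w.2
  have hpd : (monicOfFn a w.1).degree = a := by
    rw [Polynomial.degree_eq_natDegree hp.ne_zero, natDegree_monicOfFn]
  have hqd : (monicOfFn b w.2).degree = b := by
    rw [Polynomial.degree_eq_natDegree hq.ne_zero, natDegree_monicOfFn]
  have hcoeff := fun k => (fderiv_mulCoeffs_apply a b w h k).symm.trans (congrFun hh k)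
  set p := monicOfFn a w.1
  set q := monicOfFn b w.2
  set U := Polynomial.ofFn a h.1 with hUdef
  set V := Polynomial.ofFn b h.2 with hVdef
  have hzero : U * q + p * V = 0 := by
    have hdeg : (U * q + p * V).degree < (a + b : ℕ) := by
      refine (Polynomial.degree_add_le _ _).trans_lt (max_lt ?_ ?_)
      · rw [Polynomial.degree_mul, hqd, Nat.cast_add]
        exact WithBot.add_lt_add_right (by simp) hU
      · rw [Polynomial.degree_mul, hpd, Nat.cast_add]
        exact WithBot.add_lt_add_left (by simp) hV
    ext k
    rcases lt_or_ge k (a + b) with hk | hk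
    · exact hcoeff ⟨k, hk⟩
    · exact Polynomial.coeff_eq_zero_of_degree_lt (hdeg.trans_le (by exact_mod_cast hk))
  have hU0 : U = 0 := by
    refine Polynomial.eq_zero_of_dvd_of_degree_lt (p := p) (hw.dvd_of_dvd_mul_right ?_) (hpd ▸ hU)
    exact ⟨-V, by linear_combination hzero⟩
  have hV0 : V = 0 := by
    rw [hU0, zero_mul, zero_add] at hzero
    exact (mul_eq_zero.1 hzero).resolve_left hp.ne_zero
  refine Prod.ext ?_ ?_
  · have := congrArg (Polynomial.toFn a) hU0
    rwa [hUdef, Polynomial.toFn_comp_ofFn_eq_id, map_zero] at this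
  · have := congrArg (Polynomial.toFn b) hV0
    rwa [hVdef, Polynomial.toFn_comp_ofFn_eq_id, map_zero] at this

/-- A coprime factorization of a monic polynomial with analytic coefficients extends analytically
to a neighbourhood of the parameter. -/
theorem exists_analytic_factorization {P : ℝ → ℂ[X]} {t₀ : ℝ} {a b : ℕ}
    (hP : AnalyticCoeffs (𝕜 := ℝ) P t₀) (hm : ∀ t, (P t).Monic)
    (hd : ∀ t, (P t).natDegree = a + b) {p q : ℂ[X]} (hp : p.Monic) (hq : q.Monic)
    (hpa : p.natDegree = a) (hqb : q.natDegree = b) (hpq : IsCoprime p q) (h0 : P t₀ = p * q) :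
    ∃ u : ℝ → Fin a → ℂ, ∃ v : ℝ → Fin b → ℂ, (∀ i, AnalyticAt ℝ (u · i) t₀) ∧
      (∀ i, AnalyticAt ℝ (v · i) t₀) ∧
      ∀ᶠ t in 𝓝 t₀, P t = monicOfFn a (u t) * monicOfFn b (v t) := by
  set w : (Fin a → ℂ) × (Fin b → ℂ) := (fun i => p.coeff i, fun i => q.coeff i) with hw
  have hw1 : monicOfFn a w.1 = p := monicOfFn_coeff hp hpa
  have hw2 : monicOfFn b w.2 = q := monicOfFn_coeff hq hqb
  have hinj : Function.Injective (fderiv ℂ (mulCoeffs a b) w) :=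
    fderiv_mulCoeffs_injective (by rwa [hw1, hw2])
  -- Both spaces have dimension `a + b`, so injectivity makes the derivative invertible. The inverse
  -- function theorem at order `⊤` gives an analytic local inverse, which is applied to the
  -- coefficients of `P t`.
  let e : ((Fin a → ℂ) × (Fin b → ℂ)) ≃L[ℂ] (Fin (a + b) → ℂ) :=
    (LinearMap.linearEquivOfInjective (fderiv ℂ (mulCoeffs a b) w).toLinearMap hinj
      (by simp)).toContinuousLinearEquiv
  have hc : ContDiffAt ℂ ⊤ (mulCoeffs a b) w := (analyticAt_mulCoeffs a b w).contDiffAt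
  have hf : HasFDerivAt (mulCoeffs a b) (e : _ →L[ℂ] (Fin (a + b) → ℂ)) w :=
    (analyticAt_mulCoeffs a b w).differentiableAt.hasFDerivAt
  set c : ℝ → Fin (a + b) → ℂ := fun t k => (P t).coeff k with hcdef
  have hcw : mulCoeffs a b w = c t₀ := by
    ext k
    rw [mulCoeffs, hw1, hw2, hcdef, ← h0]
  have hca : AnalyticAt ℝ c t₀ := AnalyticAt.pi fun k => hP k
  have hg := (ContDiffAt.analyticAt (hc.to_localInverse hf (by simp))).restrictScalars
    (𝕜 := ℝ)
  have hr : ∀ᶠ y in 𝓝 (mulCoeffs a b w),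
      mulCoeffs a b (hc.localInverse hf (by simp) y) = y :=
    (hc.hasStrictFDerivAt' hf (by simp)).eventually_right_inverse
  set g := hc.localInverse hf (by simp)
  rw [hcw] at hg hr
  have hgc : AnalyticAt ℝ (fun t => g (c t)) t₀ := hg.comp hca
  refine ⟨fun t => (g (c t)).1, fun t => (g (c t)).2, fun i => ?_, fun i => ?_, ?_⟩
  · exact (((ContinuousLinearMap.proj (R := ℝ) (φ := fun _ : Fin a => ℂ) i).comp
      (ContinuousLinearMap.fst ℝ _ (Fin b → ℂ))).analyticAt _).comp hgc
  · exact (((ContinuousLinearMap.proj (R := ℝ) (φ := fun _ : Fin b => ℂ) i).comp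
      (ContinuousLinearMap.snd ℝ (Fin a → ℂ) _)).analyticAt _).comp hgc
  · filter_upwards [hca.continuousAt.eventually hr] with t ht
    refine monic_ext (hm t) ((monicOfFn_monic _ _).mul (monicOfFn_monic _ _)) (hd t) ?_
      fun i hi => (congrFun ht ⟨i, hi⟩).symm
    rw [(monicOfFn_monic _ _).natDegree_mul (monicOfFn_monic _ _), natDegree_monicOfFn,
      natDegree_monicOfFn]

/-! ### Bounded quotients of analytic functions -/

/-- A quotient of analytic functions of a real variable that is bounded near `t₀` is analytic. -/
theorem exists_analytic_quotient {f g : ℝ → ℂ} {t₀ C : ℝ} (hf : AnalyticAt ℝ f t₀)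
    (hg : AnalyticAt ℝ g t₀) (hg0 : ¬ ∀ᶠ t in 𝓝 t₀, g t = 0)
    (hC : ∀ᶠ t in 𝓝[≠] t₀, ‖f t‖ ≤ C * ‖g t‖) :
    ∃ h : ℝ → ℂ, AnalyticAt ℝ h t₀ ∧ ∀ᶠ t in 𝓝 t₀, f t = g t * h t := by
  by_cases hf0 : ∀ᶠ t in 𝓝 t₀, f t = 0
  · exact ⟨0, analyticAt_const, by filter_upwards [hf0] with t ht; simp [ht]⟩
  obtain ⟨a, F, hF, hF0, hfa⟩ := hf.exists_eventuallyEq_pow_smul_nonzero_iff.2 hf0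
  obtain ⟨b, G, hG, hG0, hgb⟩ := hg.exists_eventuallyEq_pow_smul_nonzero_iff.2 hg0
  have hab : b ≤ a := by
    -- If `f` vanished to lower order than `g`, cancelling the common power in the bound and letting
    -- `t → t₀` would give `F t₀ = 0`.
    by_contra! hab
    obtain ⟨d, rfl⟩ := Nat.exists_eq_add_of_lt hab
    have h1 : ∀ᶠ t in 𝓝[≠] t₀, ‖F t‖ ≤ C * (|t - t₀| ^ (d + 1) * ‖G t‖) := by
      filter_upwards [hC, nhdsWithin_le_nhds hfa, nhdsWithin_le_nhds hgb, self_mem_nhdsWithin]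
        with t h1 h2 h3 h4
      have h5 : 0 < |t - t₀| ^ a := pow_pos (abs_pos.2 (sub_ne_zero.2 h4)) _
      rw [h2, h3, norm_smul, norm_smul, norm_pow, norm_pow, Real.norm_eq_abs, add_assoc, pow_add] at h1
      refine le_of_mul_le_mul_left (h1.trans_eq ?_) h5
      ring
    have h2 : Tendsto (fun t => C * (|t - t₀| ^ (d + 1) * ‖G t‖)) (𝓝[≠] t₀) (𝓝 0) := by
      have : ContinuousAt (fun t => C * (|t - t₀| ^ (d + 1) * ‖G t‖)) t₀ := by
        have := hG.continuousAt
        fun_prop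
      have h3 := this.tendsto
      simp only [sub_self, abs_zero, pow_succ, mul_zero, zero_mul] at h3
      exact (h3.congr fun t => by rw [pow_succ]).mono_left nhdsWithin_le_nhds
    have h3 := le_of_tendsto_of_tendsto
      (hF.continuousAt.norm.tendsto.mono_left nhdsWithin_le_nhds) h2 h1
    exact hF0 (norm_le_zero_iff.1 h3)
  refine ⟨fun t => ((t - t₀) ^ (a - b)) • (F t / G t), ?_, ?_⟩
  · exact ((analyticAt_id.sub analyticAt_const).pow _).smul (hF.div hG hG0)
  · filter_upwards [hfa, hgb, hG.continuousAt.eventually_ne hG0] with t h1 h2 h3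
    rw [h1, h2]
    simp only [Complex.real_smul]
    rw [← Nat.add_sub_cancel' hab, pow_add]
    push_cast
    rw [Nat.add_sub_cancel_left]
    field_simp

theorem eq_of_eventuallyEq_punctured {f g : ℝ → ℂ} {t₀ : ℝ} (hf : ContinuousAt f t₀)
    (hg : ContinuousAt g t₀) (h : ∀ᶠ t in 𝓝[≠] t₀, f t = g t) : f t₀ = g t₀ :=
  tendsto_nhds_unique_of_eventuallyEq (hf.tendsto.mono_left nhdsWithin_le_nhds)
    (hg.tendsto.mono_left nhdsWithin_le_nhds) h

/-! ### Symmetric functions of the roots -/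

theorem esymm_two_cons (a : ℂ) (s : Multiset ℂ) :
    (a ::ₘ s).esymm 2 = s.esymm 2 + a * s.sum := by
  simpa [Multiset.esymm, Multiset.powersetCard_cons, Multiset.powersetCard_one] using
    Multiset.sum_map_mul_left (s := s) (f := id)

theorem sum_sq_eq_esymm (s : Multiset ℂ) :
    (s.map (· ^ 2)).sum = s.sum ^ 2 - 2 * s.esymm 2 := by
  induction s using Multiset.induction_on with
  | empty => rw [Multiset.esymm, Multiset.powersetCard_eq_empty _ (by simp)]; simp
  | cons a s ih => rw [esymm_two_cons, Multiset.map_cons, Multiset.sum_cons, Multiset.sum_cons, ih]; ring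

theorem monic_eq_prod_roots {P : ℂ[X]} (hP : P.Monic) :
    P = (P.roots.map fun a => Polynomial.X - Polynomial.C a).prod :=
  (IsAlgClosed.splits P).eq_prod_roots_of_monic hP

theorem card_roots_eq (P : ℂ[X]) : P.roots.card = P.natDegree :=
  ((IsAlgClosed.splits P).natDegree_eq_card_roots).symm

theorem coeff_pred_eq_neg_sum_roots {P : ℂ[X]} {n : ℕ} (hP : P.Monic) (hn : P.natDegree = n + 1) :
    P.coeff n = -P.roots.sum := by
  have hc := (card_roots_eq P).trans hn
  conv_lhs => rw [monic_eq_prod_roots hP]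
  rw [Multiset.prod_X_sub_C_coeff _ (by lia), hc, Nat.add_sub_cancel_left]
  simp [Multiset.esymm, Multiset.powersetCard_one]

/-- Newton's identity, with the sum of the roots equal to zero. It expresses the sum of squares as
an analytic function of the parameter. -/
theorem sum_sq_roots {P : ℂ[X]} {n : ℕ} (hP : P.Monic) (hn : P.natDegree = n + 2)
    (h0 : P.coeff (n + 1) = 0) : (P.roots.map (· ^ 2)).sum = -2 * P.coeff n := by
  have hc := (card_roots_eq P).trans hn
  have h1 := coeff_pred_eq_neg_sum_roots hP hn
  have h2 : P.coeff n = P.roots.esymm 2 := by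
    conv_lhs => rw [monic_eq_prod_roots hP]
    rw [Multiset.prod_X_sub_C_coeff _ (by lia), hc, Nat.add_sub_cancel_left]
    simp
  rw [sum_sq_eq_esymm, h2, neg_eq_zero.1 (h1.symm.trans h0)]
  ring

/-- The substitution translates every root by `b`. A suitable `b` makes the sum of the roots zero.
-/
theorem coeff_pred_comp_X_sub_C {P : ℂ[X]} {n : ℕ} (hP : P.Monic) (hn : P.natDegree = n + 1) (b : ℂ) :
    (P.comp (Polynomial.X - Polynomial.C b)).coeff n = P.coeff n - (n + 1) * b := by
  have hc := (card_roots_eq P).trans hn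
  have h1 : P.comp (Polynomial.X - Polynomial.C b) =
      ((P.roots.map (· + b)).map fun a => Polynomial.X - Polynomial.C a).prod := by
    conv_lhs => rw [monic_eq_prod_roots hP]
    rw [Polynomial.multiset_prod_comp, Multiset.map_map, Multiset.map_map]
    congr 1
    refine Multiset.map_congr rfl fun a _ => ?_
    simp; ring
  rw [h1, Multiset.prod_X_sub_C_coeff _ (by simp; lia), coeff_pred_eq_neg_sum_roots hP hn]
  simp [Multiset.card_map, hc, Multiset.esymm, Multiset.powersetCard_one,
    Multiset.sum_map_add]
  ring

/-- A polynomial with a single root and vanishing root sum is `X ^ (n + 2)`, whose coefficient at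
`n` is zero. So `P` has two distinct roots, and the full power of one linear factor splits off. -/
theorem exists_coprime_factorization {P : ℂ[X]} {n : ℕ} (hP : P.Monic) (hn : P.natDegree = n + 2)
    (h1 : P.coeff (n + 1) = 0) (h2 : P.coeff n ≠ 0) :
    ∃ p q : ℂ[X], p.Monic ∧ q.Monic ∧ p.natDegree < n + 2 ∧ q.natDegree < n + 2 ∧
      p.natDegree + q.natDegree = n + 2 ∧ IsCoprime p q ∧ P = p * q := by
  obtain ⟨r, hr⟩ := IsAlgClosed.exists_root P (by
    rw [Polynomial.degree_eq_natDegree hP.ne_zero, hn]; exact_mod_cast by lia)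
  obtain ⟨q, hq, hrq⟩ := Polynomial.exists_eq_pow_rootMultiplicity_mul_and_not_dvd P hP.ne_zero r
  set k := P.rootMultiplicity r
  have hk : 0 < k := (Polynomial.rootMultiplicity_pos hP.ne_zero).2 hr
  have hpm : ((Polynomial.X - Polynomial.C r) ^ k).Monic := (Polynomial.monic_X_sub_C r).pow k
  have hqm : q.Monic := hpm.of_mul_monic_left (hq ▸ hP)
  have hpd : ((Polynomial.X - Polynomial.C r) ^ k).natDegree = k := by simp
  have hsum : k + q.natDegree = n + 2 := by
    rw [← hn, hq, hpm.natDegree_mul hqm, hpd]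
  refine ⟨_, q, hpm, hqm, ?_, by lia, by rw [hpd, hsum], ?_, hq⟩
  · rw [hpd]
    by_contra! hle
    have hq1 : q = 1 := hqm.natDegree_eq_zero.1 (by lia)
    have hkn : k = n + 2 := by lia
    rw [hq1, mul_one, hkn] at hq
    have hs : P.roots = Multiset.replicate (n + 2) r := by
      rw [hq, Polynomial.roots_pow, Polynomial.roots_X_sub_C, Multiset.nsmul_singleton]
    have h3 := coeff_pred_eq_neg_sum_roots hP hn
    have h4 := sum_sq_roots hP hn h1
    rw [h1, hs] at h3
    have hr0 : r = 0 := by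
      have h5 : (0 : ℂ) = -((n + 2 : ℕ) * r) := by
        rw [h3, Multiset.sum_replicate, nsmul_eq_mul]
      exact (mul_eq_zero.1 (neg_eq_zero.1 h5.symm)).resolve_left (by norm_cast)
    rw [hs, hr0] at h4
    simp at h4
    exact h2 h4
  · refine IsCoprime.pow_left ?_
    exact (Polynomial.irreducible_X_sub_C r).coprime_iff_not_dvd.2 hrq

/-! ### Rellich's theorem for real roots -/

/-- The product of the linear factors `X - x(t)`. -/
def rootProd (l : List (ℝ → ℂ)) (t : ℝ) : ℂ[X] :=
  (l.map fun x => Polynomial.X - Polynomial.C (x t)).prod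

theorem rootProd_cons (x : ℝ → ℂ) (l : List (ℝ → ℂ)) (t : ℝ) :
    rootProd (x :: l) t = (Polynomial.X - Polynomial.C (x t)) * rootProd l t := by
  simp [rootProd]

theorem rootProd_append (l₁ l₂ : List (ℝ → ℂ)) (t : ℝ) :
    rootProd (l₁ ++ l₂) t = rootProd l₁ t * rootProd l₂ t := by
  simp [rootProd]

theorem rootProd_scaleRoots (l : List (ℝ → ℂ)) (s : ℝ → ℂ) (t : ℝ) :
    (rootProd l t).scaleRoots (s t) = rootProd (l.map fun x t => s t * x t) t := by
  induction l with
  | nil => simp [rootProd]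
  | cons x l ih =>
    rw [List.map_cons, rootProd_cons, rootProd_cons, Polynomial.mul_scaleRoots_of_noZeroDivisors, ih]
    congr 1
    have := Polynomial.X_add_C_scaleRoots (-x t) (s t)
    rwa [neg_mul, mul_comm, Polynomial.C_neg, Polynomial.C_neg, ← sub_eq_add_neg, ← sub_eq_add_neg] at this

theorem rootProd_comp (l : List (ℝ → ℂ)) (b : ℝ → ℂ) (t : ℝ) :
    (rootProd l t).comp (Polynomial.X + Polynomial.C (b t)) =
      rootProd (l.map fun x t => x t - b t) t := by
  induction l with
  | nil => simp [rootProd]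
  | cons x l ih =>
    rw [List.map_cons, rootProd_cons, rootProd_cons, Polynomial.mul_comp, ih]
    congr 1
    simp; ring

theorem analyticCoeffs_rootProd {l : List (ℝ → ℂ)} {t₀ : ℝ} (h : ∀ x ∈ l, AnalyticAt ℝ x t₀) :
    AnalyticCoeffs (𝕜 := ℝ) (rootProd l) t₀ := by
  induction l with
  | nil => exact analyticCoeffs_const 1
  | cons x l ih =>
    have h1 : rootProd (x :: l) = fun t => (Polynomial.X + Polynomial.C (-x t)) * rootProd l t := by
      ext1 t; rw [rootProd_cons]; simp [sub_eq_add_neg]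
    rw [h1]
    exact ((analyticCoeffs_const _).add (analyticCoeffs_C (h x (by simp)).neg)).mul
      (ih fun y hy => h y (by simp [hy]))

theorem isRoot_rootProd {l : List (ℝ → ℂ)} {t : ℝ} {z : ℂ} :
    (rootProd l t).IsRoot z ↔ ∃ x ∈ l, z = x t := by
  induction l with
  | nil => simp [rootProd]
  | cons x l ih => rw [rootProd_cons, Polynomial.root_mul, ih]; simp [sub_eq_zero]

/-- An analytic function that is real and nonnegative near a real point vanishes there to even
order. -/
theorem exists_even_order {S : ℝ → ℂ} {t₀ : ℝ} (hS : AnalyticAt ℝ S t₀)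
    (h0 : ¬ ∀ᶠ t in 𝓝 t₀, S t = 0) (hpos : ∀ᶠ t in 𝓝[≠] t₀, ∃ x : ℝ, 0 ≤ x ∧ S t = x) :
    ∃ (r : ℕ) (g : ℝ → ℂ), AnalyticAt ℝ g t₀ ∧ g t₀ ≠ 0 ∧
      ∀ᶠ t in 𝓝 t₀, S t = ((t - t₀ : ℝ) : ℂ) ^ (2 * r) * g t := by
  obtain ⟨k, g, hg, hg0, hSg⟩ := hS.exists_eventuallyEq_pow_smul_nonzero_iff.2 h0
  have hre : ∀ᶠ t in 𝓝[≠] t₀, ∃ x : ℝ, 0 ≤ x ∧ (t - t₀) ^ k * (g t).re = x ∧ (g t).im = 0 := by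
    filter_upwards [hpos, nhdsWithin_le_nhds hSg, self_mem_nhdsWithin] with t ⟨x, hx, h1⟩ h2 h3
    rw [h2, Complex.real_smul] at h1
    refine ⟨x, hx, ?_, ?_⟩
    · have := congrArg Complex.re h1
      rwa [Complex.re_ofReal_mul, Complex.ofReal_re] at this
    · have := congrArg Complex.im h1
      simp only [Complex.im_ofReal_mul, Complex.ofReal_im] at this
      exact (mul_eq_zero.1 this).resolve_left (pow_ne_zero _ (sub_ne_zero.2 h3))
  have hc := hg.continuousAt
  rcases Nat.even_or_odd k with ⟨r, rfl⟩ | hk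
  · refine ⟨r, g, hg, hg0, ?_⟩
    filter_upwards [hSg] with t ht
    rw [ht, Complex.real_smul, two_mul]
    push_cast
    rfl
  -- For odd `k` the factor `(t - t₀) ^ k` changes sign at `t₀`, so the real part of `g t₀` is both
  -- nonnegative and nonpositive.
  · exfalso
    have hgt : 𝓝[>] t₀ ≤ 𝓝[≠] t₀ := nhdsWithin_mono _ fun t (ht : t₀ < t) => ht.ne'
    have hlt : 𝓝[<] t₀ ≤ 𝓝[≠] t₀ := nhdsWithin_mono _ fun t (ht : t < t₀) => ht.ne
    have him : (g t₀).im = 0 := by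
      refine tendsto_nhds_unique_of_eventuallyEq (f := fun t => (g t).im) (g := fun _ => 0)
        ((Complex.continuous_im.continuousAt.comp hc).tendsto.mono_left
        (nhdsWithin_le_nhds (s := {t₀}ᶜ))) tendsto_const_nhds ?_
      filter_upwards [hre] with t ⟨_, _, _, h⟩ using h
    have hcr : Tendsto (fun t => (g t).re) (𝓝 t₀) (𝓝 (g t₀).re) :=
      (Complex.continuous_re.continuousAt.comp hc).tendsto
    have h1 : 0 ≤ (g t₀).re := by
      refine ge_of_tendsto (hcr.mono_left (nhdsWithin_le_nhds (s := Ioi t₀))) ?_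
      filter_upwards [hgt hre, self_mem_nhdsWithin] with t ⟨x, hx, h, _⟩ ht
      have : 0 < (t - t₀) ^ k := pow_pos (sub_pos.2 ht) _
      exact nonneg_of_mul_nonneg_right (h ▸ hx) this
    have h2 : (g t₀).re ≤ 0 := by
      refine le_of_tendsto (hcr.mono_left (nhdsWithin_le_nhds (s := Iio t₀))) ?_
      filter_upwards [hlt hre, self_mem_nhdsWithin] with t ⟨x, hx, h, _⟩ ht
      have : (t - t₀) ^ k < 0 := hk.pow_neg (sub_neg.2 ht)
      by_contra! hgt
      have := mul_neg_of_neg_of_pos this hgt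
      linarith
    exact hg0 (Complex.ext (le_antisymm h2 h1) him)

/-- The sum of the squares of the roots, if all roots are real. -/
theorem sum_sq_real {s : Multiset ℂ} (hs : ∀ z ∈ s, z.im = 0) :
    ∃ x : ℝ, 0 ≤ x ∧ (s.map fun z => z ^ 2).sum = (x : ℂ) ∧ ∀ z ∈ s, ‖z‖ ^ 2 ≤ x := by
  induction s using Multiset.induction_on with
  | empty => exact ⟨0, le_rfl, by simp, by simp⟩
  | cons a s ih =>
    obtain ⟨x, hx, h1, h2⟩ := ih fun z hz => hs z (Multiset.mem_cons_of_mem hz)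
    have ha : a = (a.re : ℂ) := Complex.ext (by simp) (by simp [hs a (by simp)])
    have hna : ‖a‖ ^ 2 = a.re ^ 2 := by
      rw [ha, Complex.norm_real, Real.norm_eq_abs, sq_abs, Complex.ofReal_re]
    refine ⟨a.re ^ 2 + x, by positivity, ?_, ?_⟩
    · rw [Multiset.map_cons, Multiset.sum_cons, h1]
      push_cast
      conv_lhs => rw [ha]
    · intro z hz
      rcases Multiset.mem_cons.1 hz with rfl | hz
      · rw [hna]; linarith
      · have := h2 z hz
        nlinarith [sq_nonneg a.re]

/-- The property that a family of monic polynomials of degree `n` with analytic coefficients and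
real roots can be factored analytically. -/
def HasAnalyticRoots (n : ℕ) : Prop :=
  ∀ (P : ℝ → ℂ[X]) (t₀ : ℝ), AnalyticCoeffs (𝕜 := ℝ) P t₀ → (∀ t, (P t).Monic) →
    (∀ t, (P t).natDegree = n) → (∀ᶠ t in 𝓝[≠] t₀, ∀ z, (P t).IsRoot z → z.im = 0) →
    ∃ l : List (ℝ → ℂ), (∀ x ∈ l, AnalyticAt ℝ x t₀) ∧ ∀ᶠ t in 𝓝[≠] t₀, P t = rootProd l t

/-- The inductive step when the roots at `t₀` do not all coincide: a coprime factorization at `t₀`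
persists nearby, and its factors have smaller degree and inherit real roots. -/
theorem exists_analytic_roots_of_coprime {n : ℕ} (ih : ∀ m < n + 2, HasAnalyticRoots m)
    {Q : ℝ → ℂ[X]} {t₀ : ℝ} (hQ : AnalyticCoeffs (𝕜 := ℝ) Q t₀) (hm : ∀ t, (Q t).Monic)
    (hd : ∀ t, (Q t).natDegree = n + 2)
    (hre : ∀ᶠ t in 𝓝[≠] t₀, ∀ z, (Q t).IsRoot z → z.im = 0)
    (h1 : (Q t₀).coeff (n + 1) = 0) (h2 : (Q t₀).coeff n ≠ 0) :
    ∃ l : List (ℝ → ℂ), (∀ x ∈ l, AnalyticAt ℝ x t₀) ∧ ∀ᶠ t in 𝓝[≠] t₀, Q t = rootProd l t := by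
  obtain ⟨p, q, hp, hq, hpn, hqn, hsum, hpq, hfac⟩ :=
    exists_coprime_factorization (hm t₀) (hd t₀) h1 h2
  obtain ⟨u, v, hu, hv, huv⟩ := exists_analytic_factorization hQ hm
    (fun t => (hd t).trans hsum.symm) hp hq rfl rfl hpq hfac
  have huv' := nhdsWithin_le_nhds (s := {t₀}ᶜ) huv
  obtain ⟨l₁, hl₁, h₁⟩ := ih _ hpn _ t₀ (analyticCoeffs_monicOfFn _ hu)
    (fun t => monicOfFn_monic _ _) (fun t => natDegree_monicOfFn _ _) (by
      filter_upwards [huv', hre] with t ht h z hz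
      exact h z (by rw [ht, Polynomial.root_mul]; exact Or.inl hz))
  obtain ⟨l₂, hl₂, h₂⟩ := ih _ hqn _ t₀ (analyticCoeffs_monicOfFn _ hv)
    (fun t => monicOfFn_monic _ _) (fun t => natDegree_monicOfFn _ _) (by
      filter_upwards [huv', hre] with t ht h z hz
      exact h z (by rw [ht, Polynomial.root_mul]; exact Or.inr hz))
  refine ⟨l₁ ++ l₂, fun x hx => (List.mem_append.1 hx).elim (hl₁ x) (hl₂ x), ?_⟩
  filter_upwards [huv', h₁, h₂] with t h h1 h2
  rw [h, h1, h2, rootProd_append]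

/-- The sum of squares of the real roots is nonnegative, so unless it vanishes identically near `t₀`
its order there is an even number `2r`, and every root is `O(|t - t₀|^r)`. Dividing the roots by `(t
- t₀)^r` gives an analytic family whose roots at `t₀` are not all equal, which reduces to the
coprime case. -/
theorem exists_analytic_roots_of_trace_zero {n : ℕ} (ih : ∀ m < n + 2, HasAnalyticRoots m)
    {P : ℝ → ℂ[X]} {t₀ : ℝ} (hP : AnalyticCoeffs (𝕜 := ℝ) P t₀) (hm : ∀ t, (P t).Monic)
    (hd : ∀ t, (P t).natDegree = n + 2)
    (hre : ∀ᶠ t in 𝓝[≠] t₀, ∀ z, (P t).IsRoot z → z.im = 0)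
    (htr : ∀ t, (P t).coeff (n + 1) = 0) :
    ∃ l : List (ℝ → ℂ), (∀ x ∈ l, AnalyticAt ℝ x t₀) ∧ ∀ᶠ t in 𝓝[≠] t₀, P t = rootProd l t := by
  have hsq : ∀ᶠ t in 𝓝[≠] t₀, ∃ x : ℝ, 0 ≤ x ∧ -2 * (P t).coeff n = x ∧
      ∀ z, (P t).IsRoot z → ‖z‖ ^ 2 ≤ x := by
    filter_upwards [hre] with t ht
    obtain ⟨x, hx, h1, h2⟩ := sum_sq_real (s := (P t).roots)
      fun z hz => ht z (Polynomial.isRoot_of_mem_roots hz)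
    rw [sum_sq_roots (hm t) (hd t) (htr t)] at h1
    exact ⟨x, hx, h1, fun z hz => h2 z ((Polynomial.mem_roots (hm t).ne_zero).2 hz)⟩
  have hS : AnalyticAt ℝ (fun t => -2 * (P t).coeff n) t₀ := analyticAt_const.mul (hP n)
  by_cases hS0 : ∀ᶠ t in 𝓝 t₀, -2 * (P t).coeff n = 0
  · refine ⟨List.replicate (n + 2) 0, fun x hx => ?_, ?_⟩
    · rw [List.eq_of_mem_replicate hx]
      exact analyticAt_const
    · filter_upwards [hsq, nhdsWithin_le_nhds hS0] with t ⟨x, hx, h1, h2⟩ h3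
      have hx0 : x = 0 := by rw [h3] at h1; exact_mod_cast h1.symm
      have hz : (P t).roots = Multiset.replicate (n + 2) 0 := by
        rw [Multiset.eq_replicate, card_roots_eq, hd]
        refine ⟨rfl, fun z hz => ?_⟩
        have := h2 z (Polynomial.isRoot_of_mem_roots hz)
        rw [hx0] at this
        exact norm_eq_zero.1 (pow_eq_zero_iff two_ne_zero |>.1 (le_antisymm this (sq_nonneg _)))
      rw [monic_eq_prod_roots (hm t), hz]
      simp only [rootProd, Multiset.map_replicate, Multiset.prod_replicate, List.map_replicate,
        List.prod_replicate, Pi.zero_apply]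
  obtain ⟨r, g, hg, hg0, hSg⟩ := exists_even_order hS hS0 (by
    filter_upwards [hsq] with t ⟨x, hx, h, _⟩ using ⟨x, hx, h⟩)
  set M := ‖g t₀‖ + 1 with hM
  have hM1 : 1 ≤ M := by rw [hM]; linarith [norm_nonneg (g t₀)]
  have hgM : ∀ᶠ t in 𝓝 t₀, ‖g t‖ ≤ M :=
    (hg.continuousAt.norm.eventually_lt_const (lt_add_one _)).mono fun t h => h.le
  have hroot : ∀ᶠ t in 𝓝[≠] t₀, ∀ z, (P t).IsRoot z → ‖z‖ ≤ |t - t₀| ^ r * M := by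
    filter_upwards [hsq, nhdsWithin_le_nhds hSg, nhdsWithin_le_nhds hgM]
      with t ⟨x, hx, h1, h2⟩ h3 h4 z hz
    refine abs_le_of_sq_le_sq' ?_ (by positivity) |>.2
    refine (h2 z hz).trans ?_
    have h5 : x = ‖((t - t₀ : ℝ) : ℂ) ^ (2 * r) * g t‖ := by
      rw [← h3, h1, Complex.norm_real, Real.norm_of_nonneg hx]
    rw [h5, norm_mul, norm_pow, Complex.norm_real, Real.norm_eq_abs, mul_pow, ← pow_mul, mul_comm r]
    gcongr
    nlinarith
  -- The coefficient at `j` is, up to sign, the elementary symmetric function of degree `n + 2 - j`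
  -- in the roots, so it is bounded by a multiple of `|t - t₀| ^ (r * (n + 2 - j))`.
  have hcoeff : ∀ j : Fin (n + 2), ∃ h : ℝ → ℂ, AnalyticAt ℝ h t₀ ∧
      ∀ᶠ t in 𝓝 t₀, (P t).coeff j = (((t - t₀ : ℝ) : ℂ) ^ r) ^ (n + 2 - j) * h t := by
    intro j
    refine exists_analytic_quotient (C := M ^ (n + 2 - j) * (n + 2).choose j) (hP j) ?_ ?_ ?_
    · refine ((AnalyticAt.pow ?_ r).pow _)
      exact (Complex.ofRealCLM.analyticAt _).comp (analyticAt_id.sub analyticAt_const)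
    · intro h
      have h' : ∀ᶠ t in 𝓝[≠] t₀, False := by
        filter_upwards [nhdsWithin_le_nhds h, self_mem_nhdsWithin] with t h1 h2
        exact pow_ne_zero _ (pow_ne_zero _ (Complex.ofReal_ne_zero.2 (sub_ne_zero.2 h2))) h1
      exact h'.exists.choose_spec
    · filter_upwards [hroot] with t ht
      have := Polynomial.coeff_le_of_roots_le (f := RingHom.id ℂ) (B := |t - t₀| ^ r * M) j (hm t)
        (IsAlgClosed.splits _) (fun z hz => ht z (Polynomial.isRoot_of_mem_roots (by simpa using hz)))
      rw [Polynomial.map_id, hd] at this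
      refine this.trans_eq ?_
      rw [norm_pow, norm_pow, Complex.norm_real, Real.norm_eq_abs, mul_pow]
      ring
  choose h hh hPh using hcoeff
  have hPh' := eventually_all.2 hPh
  let Q : ℝ → ℂ[X] := fun t => monicOfFn (n + 2) fun j => h j t
  have hQP : ∀ᶠ t in 𝓝 t₀, P t = (Q t).scaleRoots (((t - t₀ : ℝ) : ℂ) ^ r) := by
    filter_upwards [hPh'] with t ht
    refine monic_ext (hm t) ((Polynomial.monic_scaleRoots_iff _).2 (monicOfFn_monic _ _)) (hd t) ?_
      fun i hi => ?_
    · rw [Polynomial.natDegree_scaleRoots, natDegree_monicOfFn]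
    · rw [Polynomial.coeff_scaleRoots, natDegree_monicOfFn, mul_comm]
      exact (ht ⟨i, hi⟩).trans (by rw [coeff_monicOfFn _ _ ⟨i, hi⟩])
  have hQre : ∀ᶠ t in 𝓝[≠] t₀, ∀ z, (Q t).IsRoot z → z.im = 0 := by
    filter_upwards [nhdsWithin_le_nhds hQP, hre, self_mem_nhdsWithin] with t h1 h2 h3 z hz
    have h4 := h2 (((t - t₀ : ℝ) : ℂ) ^ r * z) (by
      rw [Polynomial.IsRoot, h1, Polynomial.scaleRoots_eval_mul, hz.eq_zero, mul_zero])
    rw [← Complex.ofReal_pow, Complex.im_ofReal_mul] at h4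
    exact (mul_eq_zero.1 h4).resolve_left (pow_ne_zero _ (sub_ne_zero.2 h3))
  have hQ1 : (Q t₀).coeff (n + 1) = 0 := by
    rw [coeff_monicOfFn _ _ ⟨n + 1, by lia⟩]
    refine eq_of_eventuallyEq_punctured (f := h ⟨n + 1, by lia⟩) (g := fun _ => 0)
      (hh _).continuousAt continuousAt_const ?_
    filter_upwards [nhdsWithin_le_nhds (hPh ⟨n + 1, by lia⟩), self_mem_nhdsWithin] with t h1 h2
    rw [htr] at h1
    refine (mul_eq_zero.1 h1.symm).resolve_left ?_
    exact pow_ne_zero _ (pow_ne_zero _ (Complex.ofReal_ne_zero.2 (sub_ne_zero.2 h2)))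
  -- The exponent at index `n` is `2r`, exactly the order of the sum of squares, so what remains at
  -- `t₀` is nonzero.
  have hQ2 : (Q t₀).coeff n = -g t₀ / 2 := by
    rw [coeff_monicOfFn _ _ ⟨n, by lia⟩]
    refine eq_of_eventuallyEq_punctured (f := h ⟨n, by lia⟩) (g := fun t => -g t / 2)
      (hh _).continuousAt (hg.continuousAt.neg.div_const _) ?_
    filter_upwards [nhdsWithin_le_nhds (hPh ⟨n, by lia⟩), nhdsWithin_le_nhds hSg,
      self_mem_nhdsWithin] with t h1 h2 h3
    have h4 : ((t - t₀ : ℝ) : ℂ) ^ (2 * r) ≠ 0 :=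
      pow_ne_zero _ (Complex.ofReal_ne_zero.2 (sub_ne_zero.2 h3))
    simp only [Nat.add_sub_cancel_left, ← pow_mul, mul_comm r] at h1
    rw [h1] at h2
    apply mul_left_cancel₀ h4
    linear_combination -h2 / 2
  obtain ⟨l, hl, hQl⟩ := exists_analytic_roots_of_coprime ih
    (analyticCoeffs_monicOfFn (n + 2) (c := fun t j => h j t) hh) (fun t => monicOfFn_monic _ _)
    (fun t => natDegree_monicOfFn _ _) hQre hQ1
    (by rw [hQ2]; exact div_ne_zero (neg_ne_zero.2 hg0) two_ne_zero)
  refine ⟨l.map fun x t => ((t - t₀ : ℝ) : ℂ) ^ r * x t, ?_, ?_⟩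
  · intro x hx
    obtain ⟨y, hy, rfl⟩ := List.mem_map.1 hx
    refine AnalyticAt.mul (AnalyticAt.pow ?_ r) (hl y hy)
    exact (Complex.ofRealCLM.analyticAt _).comp (analyticAt_id.sub analyticAt_const)
  · filter_upwards [nhdsWithin_le_nhds hQP, hQl] with t h1 h2
    rw [h1, show Q t = _ from h2]
    exact rootProd_scaleRoots l (fun t => ((t - t₀ : ℝ) : ℂ) ^ r) t

/-- **Rellich's theorem**: the roots of a monic polynomial that depends analytically on a real
parameter can be chosen analytically if all of them are real. -/
theorem hasAnalyticRoots (n : ℕ) : HasAnalyticRoots n := by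
  induction n using Nat.strong_induction_on with
  | _ n ih =>
    intro P t₀ hP hm hd hre
    match n, ih, hd with
    | 0, _, hd =>
      exact ⟨[], by simp, Eventually.of_forall fun t => by
        simpa [rootProd] using (hm t).natDegree_eq_zero.1 (hd t)⟩
    | 1, _, hd =>
      refine ⟨[fun t => -(P t).coeff 0], fun x hx => ?_, Eventually.of_forall fun t => ?_⟩
      · rw [List.mem_singleton.1 hx]
        exact (hP 0).neg
      refine monic_ext (hm t) (by simpa [rootProd] using Polynomial.monic_X_add_C _) (hd t)
        (by simp [rootProd]) fun i hi => ?_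
      obtain rfl : i = 0 := by lia
      simp [rootProd]
    | n + 2, ih, hd =>
      -- `b` is minus the mean of the roots: it is analytic, real for `t ≠ t₀` near `t₀`, and
      -- translating by it annihilates the root sum.
      set b : ℝ → ℂ := fun t => (P t).coeff (n + 1) / (n + 2) with hb
      have hba : AnalyticAt ℝ b t₀ := (hP _).div_const
      have hn2 : ((n : ℂ) + 2) ≠ 0 := by norm_cast
      have hbreal : ∀ᶠ t in 𝓝[≠] t₀, (b t).im = 0 := by
        filter_upwards [hre] with t ht
        have h1 : ((P t).roots.sum).im = 0 := by
          have : ∀ s : Multiset ℂ, (∀ z ∈ s, z.im = 0) → s.sum.im = 0 := by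
            intro s
            induction s using Multiset.induction_on with
            | empty => simp
            | cons a s ih =>
              intro h
              simp [h a (by simp), ih fun z hz => h z (by simp [hz])]
          exact this _ fun z hz => ht z (Polynomial.isRoot_of_mem_roots hz)
        have h2 : b t = (P t).coeff (n + 1) / ((n + 2 : ℝ) : ℂ) := by simp [hb]
        rw [h2, Complex.div_ofReal_im, coeff_pred_eq_neg_sum_roots (hm t) (hd t), Complex.neg_im, h1]
        simp
      have h1 : AnalyticCoeffs (𝕜 := ℝ)
          (fun t => (P t).comp (Polynomial.X - Polynomial.C (b t))) t₀ := by
        have h1 : ∀ t, (P t).comp (Polynomial.X - Polynomial.C (b t)) =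
            ∑ i ∈ Finset.range (n + 3), Polynomial.C ((P t).coeff i) *
              (Polynomial.X + Polynomial.C (-b t)) ^ i := by
          intro t
          rw [Polynomial.comp, Polynomial.eval₂_eq_sum_range, hd]
          simp [sub_eq_add_neg]
        simp only [h1]
        exact analyticCoeffs_sum _ fun i _ => (analyticCoeffs_C (hP i)).mul
          (((analyticCoeffs_const _).add (analyticCoeffs_C hba.neg)).pow i)
      have h2 : ∀ᶠ t in 𝓝[≠] t₀, ∀ z,
          ((P t).comp (Polynomial.X - Polynomial.C (b t))).IsRoot z → z.im = 0 := by
        filter_upwards [hre, hbreal] with t h1 h2 z hz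
        have := h1 (z - b t) (by simpa [Polynomial.IsRoot, Polynomial.eval_comp] using hz)
        simpa [h2] using this
      have h3 : ∀ t, ((P t).comp (Polynomial.X - Polynomial.C (b t))).coeff (n + 1) = 0 := by
        intro t
        rw [coeff_pred_comp_X_sub_C (hm t) (hd t), hb]
        push_cast
        field_simp
        ring
      obtain ⟨l, hl, hPl⟩ := exists_analytic_roots_of_trace_zero ih h1
        (fun t => (hm t).comp (Polynomial.monic_X_sub_C _) (by simp))
        (fun t => by rw [Polynomial.natDegree_comp, hd]; simp) h2 h3
      refine ⟨l.map fun x t => x t - b t, ?_, ?_⟩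
      · intro x hx
        obtain ⟨y, hy, rfl⟩ := List.mem_map.1 hx
        exact (hl y hy).sub hba
      · filter_upwards [hPl] with t ht
        rw [← rootProd_comp, ← ht, Polynomial.comp_assoc]
        simp

theorem eventually_eq_rootProd_nhds {P : ℝ → ℂ[X]} {t₀ : ℝ} {l : List (ℝ → ℂ)}
    (hP : AnalyticCoeffs (𝕜 := ℝ) P t₀) (hl : ∀ x ∈ l, AnalyticAt ℝ x t₀)
    (h : ∀ᶠ t in 𝓝[≠] t₀, P t = rootProd l t) : ∀ᶠ t in 𝓝 t₀, P t = rootProd l t := by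
  have h0 : P t₀ = rootProd l t₀ := by
    ext k
    exact eq_of_eventuallyEq_punctured (hP k).continuousAt
      (analyticCoeffs_rootProd hl k).continuousAt (h.mono fun t ht => by rw [ht])
  filter_upwards [eventually_nhdsWithin_iff.1 h] with t ht
  by_cases h1 : t = t₀
  · rw [h1, h0]
  · exact ht h1

/-! ### Cayley transform and roots on the unit circle -/

/-- The numerator of `P (ω (1 + i x) / (1 - i x))`. -/
def cayleyPoly (ω : ℂ) (n : ℕ) (P : ℂ[X]) : ℂ[X] :=
  ∑ j ∈ Finset.range (n + 1), Polynomial.C (P.coeff j) * (Polynomial.C (ω ^ j) *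
    ((1 + Polynomial.C Complex.I * Polynomial.X) ^ j *
      (1 - Polynomial.C Complex.I * Polynomial.X) ^ (n - j)))

theorem natDegree_one_add_C_mul_X (a : ℂ) :
    (1 + Polynomial.C a * Polynomial.X).natDegree ≤ 1 := by
  refine (Polynomial.natDegree_add_le _ _).trans ?_
  simp only [Polynomial.natDegree_one, zero_le, sup_of_le_right]
  exact Polynomial.natDegree_C_mul_le _ _ |>.trans Polynomial.natDegree_X_le

theorem coeff_one_add_C_mul_X_pow (a : ℂ) (j : ℕ) :
    ((1 + Polynomial.C a * Polynomial.X) ^ j).coeff j = a ^ j := by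
  have := Polynomial.coeff_pow_of_natDegree_le (m := j) (natDegree_one_add_C_mul_X a)
  rw [mul_one] at this
  rw [this]
  simp [Polynomial.coeff_one]

theorem one_sub_C_mul_X (a : ℂ) :
    (1 - Polynomial.C a * Polynomial.X : ℂ[X]) = 1 + Polynomial.C (-a) * Polynomial.X := by
  simp [sub_eq_add_neg]

theorem natDegree_one_add_C_mul_X_pow (a : ℂ) (j : ℕ) :
    ((1 + Polynomial.C a * Polynomial.X) ^ j).natDegree ≤ j :=
  (Polynomial.natDegree_pow_le_of_le j (natDegree_one_add_C_mul_X a)).trans (by simp)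

theorem natDegree_cayleyPoly (ω : ℂ) (n : ℕ) (P : ℂ[X]) : (cayleyPoly ω n P).natDegree ≤ n := by
  refine Polynomial.natDegree_sum_le_of_forall_le _ _ fun j hj => ?_
  refine (Polynomial.natDegree_C_mul_le _ _).trans ((Polynomial.natDegree_C_mul_le _ _).trans ?_)
  rw [one_sub_C_mul_X]
  refine (Polynomial.natDegree_mul_le_of_le (natDegree_one_add_C_mul_X_pow _ _)
    (natDegree_one_add_C_mul_X_pow _ _)).trans ?_
  have := Finset.mem_range.1 hj
  lia

/-- The point `-ω` corresponds to `x = ∞`, so the transform keeps full degree exactly when `-ω` is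
not a root of `P`. -/
theorem coeff_cayleyPoly {ω : ℂ} {n : ℕ} {P : ℂ[X]} (hn : P.natDegree = n) :
    (cayleyPoly ω n P).coeff n = (-Complex.I) ^ n * P.eval (-ω) := by
  rw [cayleyPoly, Polynomial.finsetSum_coeff, Polynomial.eval_eq_sum_range, hn, Finset.mul_sum]
  refine Finset.sum_congr rfl fun j hj => ?_
  have hj' : j + (n - j) = n := by have := Finset.mem_range.1 hj; lia
  rw [Polynomial.coeff_C_mul, Polynomial.coeff_C_mul, one_sub_C_mul_X]
  have h1 := Polynomial.coeff_mul_add_eq_of_natDegree_le (natDegree_one_add_C_mul_X_pow Complex.I j)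
    (natDegree_one_add_C_mul_X_pow (-Complex.I) (n - j))
  rw [hj'] at h1
  rw [h1, coeff_one_add_C_mul_X_pow, coeff_one_add_C_mul_X_pow]
  have h2 : (-Complex.I) ^ n = (-Complex.I) ^ j * (-Complex.I) ^ (n - j) := by
    rw [← pow_add, hj']
  rw [h2, neg_pow ω]
  have h3 : Complex.I ^ j = (-1) ^ j * (-Complex.I) ^ j := by rw [← mul_pow]; simp
  rw [h3]
  ring

theorem eval_cayleyPoly {ω : ℂ} {n : ℕ} {P : ℂ[X]} (hn : P.natDegree = n) {x : ℂ}
    (hx : 1 - Complex.I * x ≠ 0) :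
    (cayleyPoly ω n P).eval x = (1 - Complex.I * x) ^ n *
      P.eval (ω * (1 + Complex.I * x) / (1 - Complex.I * x)) := by
  rw [cayleyPoly, Polynomial.eval_finsetSum, Polynomial.eval_eq_sum_range, hn, Finset.mul_sum]
  refine Finset.sum_congr rfl fun j hj => ?_
  have hj' : j + (n - j) = n := by have := Finset.mem_range.1 hj; lia
  have h2 : (1 - Complex.I * x) ^ n = (1 - Complex.I * x) ^ j * (1 - Complex.I * x) ^ (n - j) := by
    rw [← pow_add, hj']
  rw [h2]
  simp only [Polynomial.eval_mul, Polynomial.eval_C, Polynomial.eval_pow, Polynomial.eval_add,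
    Polynomial.eval_one, Polynomial.eval_X, Polynomial.eval_sub, div_pow, mul_pow]
  field_simp

/-- At the pole `x = -i` every term but `j = n` contains a factor zero. Hence the transform acquires
no spurious root there. -/
theorem eval_cayleyPoly_ne_zero {ω : ℂ} {n : ℕ} {P : ℂ[X]} (hP : P.Monic) (hn : P.natDegree = n)
    (hω : ω ≠ 0) {x : ℂ} (hx : 1 - Complex.I * x = 0) : (cayleyPoly ω n P).eval x ≠ 0 := by
  have hx' : Complex.I * x = 1 := by linear_combination -hx
  rw [cayleyPoly, Polynomial.eval_finsetSum, Finset.sum_eq_single n]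
  · have : P.coeff n = 1 := hn ▸ hP.coeff_natDegree
    simp [this, hx', hω]
  · intro j hj hjn
    have : n - j ≠ 0 := by have := Finset.mem_range.1 hj; lia
    simp [hx', this]
  · simp

theorem isRoot_cayleyPoly_iff {ω : ℂ} {n : ℕ} {P : ℂ[X]} (hn : P.natDegree = n)
    (hω : ω ≠ 0) (hPω : P.eval (-ω) ≠ 0) (z : ℂ) :
    P.IsRoot z ↔ ∃ x, (cayleyPoly ω n P).IsRoot x ∧ 1 - Complex.I * x ≠ 0 ∧
      z = ω * (1 + Complex.I * x) / (1 - Complex.I * x) := by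
  constructor
  · intro hz
    -- The preimage of `z` under the Cayley map is `i(ω - z)/(ω + z)`.
    have hne : ω + z ≠ 0 := by
      intro h
      rw [add_eq_zero_iff_neg_eq] at h
      exact hPω (h ▸ hz)
    have hx1 : 1 - Complex.I * (Complex.I * (ω - z) / (ω + z)) = 2 * ω / (ω + z) := by
      field_simp
      linear_combination -(ω - z) * Complex.I_sq
    have hx2 : 1 + Complex.I * (Complex.I * (ω - z) / (ω + z)) = 2 * z / (ω + z) := by
      field_simp
      linear_combination (ω - z) * Complex.I_sq
    have h1 : 1 - Complex.I * (Complex.I * (ω - z) / (ω + z)) ≠ 0 := by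
      rw [hx1]
      exact div_ne_zero (mul_ne_zero two_ne_zero hω) hne
    have h2 : z = ω * (1 + Complex.I * (Complex.I * (ω - z) / (ω + z))) /
        (1 - Complex.I * (Complex.I * (ω - z) / (ω + z))) := by
      rw [hx1, hx2]
      field_simp
    refine ⟨_, ?_, h1, h2⟩
    rw [Polynomial.IsRoot, eval_cayleyPoly hn h1, ← h2, hz.eq_zero, mul_zero]
  · rintro ⟨x, hx, h1, rfl⟩
    rw [Polynomial.IsRoot, eval_cayleyPoly hn h1] at hx
    exact (mul_eq_zero.1 hx).resolve_left (pow_ne_zero _ h1)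

theorem one_sub_I_mul_ofReal_ne_zero (x : ℝ) : 1 - Complex.I * x ≠ 0 := by
  intro h
  have := congrArg Complex.re h
  simp at this

/-- The numbers `|1 + ix|²` and `|1 - ix|²` differ by `4 Im x` in absolute value. -/
theorem im_eq_zero_of_norm_cayley {ω x : ℂ} (hω : ‖ω‖ = 1) (hx : 1 - Complex.I * x ≠ 0)
    (h : ‖ω * (1 + Complex.I * x) / (1 - Complex.I * x)‖ = 1) : x.im = 0 := by
  rw [norm_div, norm_mul, hω, one_mul, div_eq_one_iff_eq (norm_ne_zero_iff.2 hx)] at h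
  have h2 : Complex.normSq (1 + Complex.I * x) = Complex.normSq (1 - Complex.I * x) := by
    rw [Complex.normSq_eq_norm_sq, Complex.normSq_eq_norm_sq, h]
  simp [Complex.normSq_apply] at h2
  nlinarith

theorem exp_two_arctan (x : ℝ) : Complex.exp ((2 * Real.arctan x : ℝ) * Complex.I) =
    (1 + Complex.I * x) / (1 - Complex.I * x) := by
  have hc : Real.cos (Real.arctan x) ≠ 0 := (Real.cos_arctan_pos x).ne'
  have ht : Real.sin (Real.arctan x) = x * Real.cos (Real.arctan x) := by
    have := Real.tan_arctan x
    rw [Real.tan_eq_sin_div_cos, div_eq_iff hc] at this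
    exact this
  obtain ⟨c, hcdef⟩ : ∃ c, Real.cos (Real.arctan x) = c := ⟨_, rfl⟩
  rw [hcdef] at hc ht
  have hE : Complex.exp (Real.arctan x * Complex.I) = c * (1 + Complex.I * x) := by
    rw [Complex.exp_mul_I, ← Complex.ofReal_cos, ← Complex.ofReal_sin, ht, hcdef]
    push_cast; ring
  have hE' : Complex.exp (-(Real.arctan x * Complex.I)) = c * (1 - Complex.I * x) := by
    rw [← neg_mul, Complex.exp_mul_I, Complex.cos_neg, Complex.sin_neg, ← Complex.ofReal_cos,
      ← Complex.ofReal_sin, ht, hcdef]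
    push_cast; ring
  have h1 : ((2 * Real.arctan x : ℝ) * Complex.I) =
      Real.arctan x * Complex.I - -(Real.arctan x * Complex.I) := by push_cast; ring
  rw [h1, Complex.exp_sub, hE, hE', mul_div_mul_left _ _ (Complex.ofReal_ne_zero.2 hc)]

theorem analyticAt_arctan (x : ℝ) : AnalyticAt ℝ Real.arctan x :=
  (Real.contDiff_arctan (n := ⊤)).contDiffAt.analyticAt

theorem exists_unit_not_isRoot {P : ℂ[X]} (hP : P ≠ 0) : ∃ s : ℝ,
    P.eval (-Complex.exp (s * Complex.I)) ≠ 0 := by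
  by_contra! h
  refine hP (Polynomial.eq_zero_of_infinite_isRoot P ?_)
  have hinj : InjOn (fun s : ℝ => -Complex.exp (s * Complex.I)) (Ioc (-Real.pi) Real.pi) := by
    intro s hs t ht hst
    have h1 := congrArg Complex.arg (neg_injective hst)
    rwa [Complex.arg_exp_mul_I, Complex.arg_exp_mul_I,
      (toIocMod_eq_self Real.two_pi_pos).2 (by rwa [show -Real.pi + 2 * Real.pi = Real.pi by ring]),
      (toIocMod_eq_self Real.two_pi_pos).2 (by rwa [show -Real.pi + 2 * Real.pi = Real.pi by ring])] at h1
  refine ((Ioc_infinite (by linarith [Real.pi_pos])).image hinj).mono ?_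
  rintro _ ⟨s, _, rfl⟩
  exact h s

/-- Rellich's theorem for polynomials whose roots lie on the unit circle. -/
theorem exists_analytic_args {n : ℕ} {P : ℝ → ℂ[X]} {t₀ : ℝ} (hP : AnalyticCoeffs (𝕜 := ℝ) P t₀)
    (hm : ∀ t, (P t).Monic) (hd : ∀ t, (P t).natDegree = n)
    (hT : ∀ᶠ t in 𝓝[≠] t₀, ∀ z, (P t).IsRoot z → ‖z‖ = 1) :
    ∃ l : List (ℝ → ℝ), (∀ θ ∈ l, AnalyticAt ℝ θ t₀) ∧
      ∀ᶠ t in 𝓝 t₀, ∀ z, (P t).IsRoot z ↔ ∃ θ ∈ l, z = Complex.exp (θ t * Complex.I) := by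
  -- With `-ω` off the roots of `P t₀`, the leading coefficient of the transform is nonzero near
  -- `t₀`, so normalizing to a monic family keeps coefficients analytic.
  obtain ⟨s, hs⟩ := exists_unit_not_isRoot (hm t₀).ne_zero
  set ω := Complex.exp (s * Complex.I) with hωdef
  have hω1 : ‖ω‖ = 1 := Complex.norm_exp_ofReal_mul_I s
  have hω0 : ω ≠ 0 := Complex.exp_ne_zero _
  have hR : AnalyticCoeffs (𝕜 := ℝ) (fun t => cayleyPoly ω n (P t)) t₀ :=
    analyticCoeffs_sum _ fun j _ => (analyticCoeffs_C (hP j)).mul (analyticCoeffs_const _)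
  have hL0 : (cayleyPoly ω n (P t₀)).coeff n ≠ 0 := by
    rw [coeff_cayleyPoly (hd t₀)]
    exact mul_ne_zero (pow_ne_zero _ (neg_ne_zero.2 Complex.I_ne_zero)) hs
  have hL := (hR n).continuousAt.eventually_ne hL0
  let Q : ℝ → ℂ[X] := fun t => monicOfFn n fun j =>
    (cayleyPoly ω n (P t)).coeff j / (cayleyPoly ω n (P t)).coeff n
  have hQa : AnalyticCoeffs (𝕜 := ℝ) Q t₀ :=
    analyticCoeffs_monicOfFn n fun j => (hR j).div (hR n) hL0
  have hQR : ∀ᶠ t in 𝓝 t₀, ∀ x, (Q t).IsRoot x ↔ (cayleyPoly ω n (P t)).IsRoot x := by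
    filter_upwards [hL] with t ht x
    have : cayleyPoly ω n (P t) = Polynomial.C ((cayleyPoly ω n (P t)).coeff n) * Q t := by
      ext k
      rw [Polynomial.coeff_C_mul]
      rcases lt_trichotomy k n with hk | rfl | hk
      · rw [coeff_monicOfFn _ _ ⟨k, hk⟩]
        field_simp
      · have : (Q t).coeff k = 1 := by
          have := (monicOfFn_monic k fun j =>
            (cayleyPoly ω k (P t)).coeff j / (cayleyPoly ω k (P t)).coeff k).coeff_natDegree
          rwa [natDegree_monicOfFn] at this
        rw [this, mul_one]
      · rw [Polynomial.coeff_eq_zero_of_natDegree_lt ((natDegree_cayleyPoly _ _ _).trans_lt hk),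
          Polynomial.coeff_eq_zero_of_natDegree_lt ((natDegree_monicOfFn _ _).trans_lt hk), mul_zero]
    conv_rhs => rw [this]
    simp [Polynomial.IsRoot, ht]
  have hPω : ∀ᶠ t in 𝓝 t₀, (P t).eval (-ω) ≠ 0 := by
    filter_upwards [hL] with t ht
    rw [coeff_cayleyPoly (hd t)] at ht
    exact right_ne_zero_of_mul ht
  have hQre : ∀ᶠ t in 𝓝[≠] t₀, ∀ x, (Q t).IsRoot x → x.im = 0 := by
    filter_upwards [nhdsWithin_le_nhds hQR, nhdsWithin_le_nhds hPω, hT] with t h1 h2 h3 x hx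
    have h4 := (h1 x).1 hx
    have h5 : 1 - Complex.I * x ≠ 0 := fun h =>
      eval_cayleyPoly_ne_zero (hm t) (hd t) hω0 h h4
    exact im_eq_zero_of_norm_cayley hω1 h5 (h3 _
      ((isRoot_cayleyPoly_iff (hd t) hω0 h2 _).2 ⟨x, h4, h5, rfl⟩))
  obtain ⟨l, hl, hQl⟩ := hasAnalyticRoots n Q t₀ hQa (fun t => monicOfFn_monic _ _)
    (fun t => natDegree_monicOfFn _ _) hQre
  have hQl' := eventually_eq_rootProd_nhds hQa hl hQl
  have him : ∀ᶠ t in 𝓝 t₀, ∀ x ∈ l, (x t).im = 0 := by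
    have h1 : ∀ᶠ t in 𝓝[≠] t₀, ∀ x ∈ l, (x t).im = 0 := by
      filter_upwards [hQl, hQre] with t h1 h2 x hx
      exact h2 _ (by rw [h1, isRoot_rootProd]; exact ⟨x, hx, rfl⟩)
    have h2 : ∀ x ∈ l, (x t₀).im = 0 := fun x hx =>
      tendsto_nhds_unique_of_eventuallyEq (f := fun t => (x t).im) (g := fun _ => 0)
        ((Complex.continuous_im.continuousAt.comp (hl x hx).continuousAt).tendsto.mono_left
        (nhdsWithin_le_nhds (s := {t₀}ᶜ))) tendsto_const_nhds (h1.mono fun t ht => ht x hx)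
    filter_upwards [eventually_nhdsWithin_iff.1 h1] with t ht
    by_cases h3 : t = t₀
    · rwa [h3]
    · exact ht h3
  refine ⟨l.map fun x t => s + 2 * Real.arctan (x t).re, ?_, ?_⟩
  · intro θ hθ
    obtain ⟨x, hx, rfl⟩ := List.mem_map.1 hθ
    refine analyticAt_const.add (analyticAt_const.mul ?_)
    exact (analyticAt_arctan _).comp ((Complex.reCLM.analyticAt _).comp (hl x hx))
  · filter_upwards [hQR, hPω, hQl', him] with t h1 h2 h3 h4 z
    have h5 : ∀ x ∈ l, Complex.exp ((s + 2 * Real.arctan (x t).re : ℝ) * Complex.I) =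
        ω * (1 + Complex.I * x t) / (1 - Complex.I * x t) := by
      intro x hx
      have : x t = ((x t).re : ℂ) := Complex.ext (by simp) (by simp [h4 x hx])
      rw [Complex.ofReal_add, add_mul, Complex.exp_add, exp_two_arctan, ← this, mul_div_assoc]
    rw [isRoot_cayleyPoly_iff (hd t) hω0 h2]
    constructor
    · rintro ⟨x, hx, -, rfl⟩
      rw [← h1, h3, isRoot_rootProd] at hx
      obtain ⟨y, hy, rfl⟩ := hx
      exact ⟨_, List.mem_map.2 ⟨y, hy, rfl⟩, (h5 y hy).symm⟩
    · rintro ⟨θ, hθ, rfl⟩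
      obtain ⟨x, hx, rfl⟩ := List.mem_map.1 hθ
      refine ⟨x t, ?_, ?_, h5 x hx⟩
      · rw [← h1, h3, isRoot_rootProd]
        exact ⟨x, hx, rfl⟩
      · have : x t = ((x t).re : ℂ) := Complex.ext (by simp) (by simp [h4 x hx])
        rw [this]
        exact one_sub_I_mul_ofReal_ne_zero _

/-! ### Local branches over the circle -/

/-- The point `e^{it}` of the unit circle. -/
def circ (t : ℝ) : ℂ := Complex.exp (t * Complex.I)

theorem norm_circ (t : ℝ) : ‖circ t‖ = 1 := Complex.norm_exp_ofReal_mul_I t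

theorem analyticAt_circ (t : ℝ) : AnalyticAt ℝ circ t :=
  analyticAt_cexp.restrictScalars.comp ((Complex.ofRealCLM.analyticAt t).mul analyticAt_const)

theorem hasDerivAt_circ (t : ℝ) : HasDerivAt circ (circ t * Complex.I) t := by
  have h := ((hasDerivAt_id (t : ℂ)).mul_const Complex.I).cexp.comp_ofReal
  simp only [id_eq, one_mul] at h
  exact h

theorem eventually_eval_circ_ne_zero {f : ℂ[X]} (hf : f ≠ 0) (t₀ : ℝ) :
    ∀ᶠ t in 𝓝[≠] t₀, f.eval (circ t) ≠ 0 := by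
  have h1 : Tendsto circ (𝓝[≠] t₀) (𝓝[≠] (circ t₀)) :=
    (hasDerivAt_circ t₀).tendsto_nhdsNE (mul_ne_zero (Complex.exp_ne_zero _) Complex.I_ne_zero)
  refine h1.eventually (p := fun z => f.eval z ≠ 0) ?_
  have h2 : ({z | f.IsRoot z} \ {circ t₀}).Finite := (Polynomial.finite_setOfPred_isRoot hf).sdiff
  have h3 := h2.isClosed.isOpen_compl.mem_nhds (x := circ t₀) (by simp)
  filter_upwards [nhdsWithin_le_nhds h3, self_mem_nhdsWithin] with z hz hz1 hz2
  exact hz ⟨hz2, hz1⟩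

theorem analyticAt_eval_circ (f : ℂ[X]) (t₀ : ℝ) : AnalyticAt ℝ (fun t => f.eval (circ t)) t₀ := by
  have h : (fun t => f.eval (circ t)) =
      fun t => ∑ i ∈ Finset.range (f.natDegree + 1), f.coeff i * circ t ^ i := by
    ext t; rw [Polynomial.eval_eq_sum_range]
  rw [h]
  exact Finset.analyticAt_fun_sum _ fun i _ => analyticAt_const.mul ((analyticAt_circ t₀).pow i)

/-- The polynomial `G(·, w)` in the first variable `z`, where `G` is a polynomial in `z` with
coefficients that are polynomials in `w`. -/
def slice (G : ℂ[X][X]) (w : ℂ) : ℂ[X] := G.map (Polynomial.evalRingHom w)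

theorem coeff_slice (G : ℂ[X][X]) (w : ℂ) (k : ℕ) : (slice G w).coeff k = (G.coeff k).eval w := by
  simp [slice]

/-- Local parametrization of the zeros on the 2-torus of a polynomial all of whose slices over
points of the unit circle either vanish or have all their zeros on the unit circle. -/
theorem exists_local_branches {G : ℂ[X][X]} (hG : G ≠ 0)
    (hT : ∀ w, ‖w‖ = 1 → ∀ z, (slice G w).IsRoot z → ‖z‖ = 1 ∨ slice G w = 0) (t₀ : ℝ) :
    ∃ l : List (ℝ → ℝ), (∀ θ ∈ l, AnalyticAt ℝ θ t₀) ∧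
      ∀ᶠ t in 𝓝 t₀, (∀ θ ∈ l, (slice G (circ t)).IsRoot (circ (θ t))) ∧
        (t ≠ t₀ → slice G (circ t) ≠ 0) ∧
        (slice G (circ t) ≠ 0 → ∀ z, (slice G (circ t)).IsRoot z → ∃ θ ∈ l, z = circ (θ t)) := by
  set n := G.natDegree with hn
  set f : ℂ[X] := G.leadingCoeff with hf
  have hf0 : f ≠ 0 := Polynomial.leadingCoeff_ne_zero.2 hG
  have hfn : ∀ w, (slice G w).coeff n = f.eval w := fun w => coeff_slice G w n
  have hdeg : ∀ w, (slice G w).natDegree ≤ n := fun w => Polynomial.natDegree_map_le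
  have hne := eventually_eval_circ_ne_zero hf0 t₀
  have hmonic : ∀ t, f.eval (circ t) ≠ 0 →
      (Polynomial.C (f.eval (circ t))⁻¹ * slice G (circ t)).Monic ∧
      (Polynomial.C (f.eval (circ t))⁻¹ * slice G (circ t)).natDegree = n := by
    intro t ht
    have h1 : (slice G (circ t)).natDegree = n :=
      le_antisymm (hdeg _) (Polynomial.le_natDegree_of_ne_zero (by rwa [hfn]))
    refine ⟨?_, by rw [Polynomial.natDegree_C_mul (inv_ne_zero ht), h1]⟩
    rw [Polynomial.Monic, Polynomial.leadingCoeff_mul, Polynomial.leadingCoeff_C,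
      Polynomial.leadingCoeff, h1, hfn, inv_mul_cancel₀ ht]
  have hquot : ∀ j : Fin n, ∃ h : ℝ → ℂ, AnalyticAt ℝ h t₀ ∧
      ∀ᶠ t in 𝓝 t₀, (G.coeff j).eval (circ t) = f.eval (circ t) * h t := by
    intro j
    -- Where the leading coefficient is nonzero, the normalized slice is monic with roots of modulus
    -- `1`, so its coefficients are at most binomial coefficients.
    refine exists_analytic_quotient (C := n.choose j) (analyticAt_eval_circ _ _)
      (analyticAt_eval_circ _ _) ?_ ?_
    · intro h
      obtain ⟨t, h1, h2⟩ := (hne.and (nhdsWithin_le_nhds h)).exists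
      exact h1 h2
    · filter_upwards [hne] with t ht
      have h1 := Polynomial.coeff_le_of_roots_le (f := RingHom.id ℂ) (B := 1) j (hmonic t ht).1
        (IsAlgClosed.splits _) (by
          intro z hz
          have hz1 := Polynomial.isRoot_of_mem_roots hz
          rw [Polynomial.map_id, Polynomial.IsRoot, Polynomial.eval_mul, Polynomial.eval_C] at hz1
          have hz2 := (mul_eq_zero.1 hz1).resolve_left (inv_ne_zero ht)
          refine ((hT _ (norm_circ t) z hz2).resolve_right fun h0 => ht ?_).le
          rw [← hfn, h0, Polynomial.coeff_zero])
      rw [Polynomial.map_id, (hmonic t ht).2, one_pow, one_mul, Polynomial.coeff_C_mul, norm_mul,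
        norm_inv, coeff_slice, inv_mul_le_iff₀ (norm_pos_iff.2 ht)] at h1
      rwa [mul_comm]
  choose h hh hfh using hquot
  have hfh' := eventually_all.2 hfh
  -- The scalar factor carries all the vanishing of slices; the monic factor has analytic
  -- coefficients even at `t₀`.
  have hGP : ∀ᶠ t in 𝓝 t₀, slice G (circ t) =
      Polynomial.C (f.eval (circ t)) * monicOfFn n fun j => h j t := by
    filter_upwards [hfh'] with t ht
    ext k
    rw [Polynomial.coeff_C_mul]
    rcases lt_trichotomy k n with hk | rfl | hk
    · rw [coeff_monicOfFn _ _ ⟨k, hk⟩, coeff_slice]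
      exact ht ⟨k, hk⟩
    · have h2 := (monicOfFn_monic n fun j => h j t).coeff_natDegree
      rw [natDegree_monicOfFn] at h2
      rw [h2, mul_one, hfn]
    · rw [Polynomial.coeff_eq_zero_of_natDegree_lt ((hdeg _).trans_lt hk),
        Polynomial.coeff_eq_zero_of_natDegree_lt ((natDegree_monicOfFn _ _).trans_lt hk), mul_zero]
  obtain ⟨l, hl, hroots⟩ := exists_analytic_args
    (analyticCoeffs_monicOfFn n (c := fun t j => h j t) hh) (fun t => monicOfFn_monic _ _)
    (fun t => natDegree_monicOfFn _ _) (by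
      filter_upwards [hne, nhdsWithin_le_nhds hGP] with t h1 h2 z hz
      refine (hT _ (norm_circ t) z ?_).resolve_right fun h0 => h1 (by rw [← hfn, h0]; simp)
      rw [h2, Polynomial.root_mul]
      exact Or.inr hz)
  refine ⟨l, hl, ?_⟩
  filter_upwards [hGP, hroots, eventually_nhdsWithin_iff.1 hne] with t h1 h2 h3
  refine ⟨fun θ hθ => ?_, fun ht h0 => h3 ht (by rw [← hfn, h0]; simp), fun h0 z hz => ?_⟩
  · rw [h1, Polynomial.root_mul]
    exact Or.inr ((h2 _).2 ⟨θ, hθ, rfl⟩)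
  · rw [h1] at h0 hz
    refine (h2 z).1 ((Polynomial.root_mul.1 hz).resolve_left fun h4 => h0 ?_)
    rw [Polynomial.IsRoot, Polynomial.eval_C] at h4
    rw [h4, Polynomial.C_0, zero_mul]

/-! ### Analytic continuation of branches -/

/-- If an analytic function agrees at every point of an interval with one of countably many
analytic functions, then it agrees with one of them on the whole interval. -/
theorem exists_eqOn_of_countable_cover {S : Set (ℝ → ℝ)} (hS : S.Countable) {f : ℝ → ℝ} {a b : ℝ}
    (hab : a < b) (hf : AnalyticOnNhd ℝ f (Ioo a b)) (hSa : ∀ θ ∈ S, AnalyticOnNhd ℝ θ (Ioo a b))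
    (h : ∀ t ∈ Ioo a b, ∃ θ ∈ S, f t = θ t) : ∃ θ ∈ S, EqOn f θ (Ioo a b) := by
  by_contra! hne
  -- Distinct analytic functions on an interval agree only on a null set, and countably many null
  -- sets cannot cover the interval.
  have h1 : ∀ θ ∈ S, ∀ᵐ t ∂(MeasureTheory.volume.restrict (Ioo a b)), f t ≠ θ t := by
    intro θ hθ
    exact ae_restrict_le_codiscreteWithin measurableSet_Ioo
      ((hf.eqOn_or_eventually_ne_of_preconnected (hSa θ hθ) isPreconnected_Ioo).resolve_left
        (hne θ hθ))
  have h2 := (MeasureTheory.ae_ball_iff hS).2 h1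
  have h3 := h2.and (MeasureTheory.ae_restrict_mem measurableSet_Ioo)
  have : (MeasureTheory.ae (MeasureTheory.volume.restrict (Ioo a b))).NeBot := by
    rw [MeasureTheory.ae_neBot, Ne, MeasureTheory.Measure.restrict_eq_zero, Real.volume_Ioo]
    simpa using hab
  obtain ⟨t, h4, h5⟩ := h3.exists
  obtain ⟨θ, hθ, h6⟩ := h t h5
  exact h4 θ hθ h6

/-- `f` is an analytic solution of the relation `Z` over the set `U`. -/
def IsBranchOn (Z : ℝ → ℝ → Prop) (f : ℝ → ℝ) (U : Set ℝ) : Prop :=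
  AnalyticOnNhd ℝ f U ∧ ∀ t ∈ U, Z t (f t)

theorem IsBranchOn.mono {Z : ℝ → ℝ → Prop} {f : ℝ → ℝ} {U V : Set ℝ} (h : IsBranchOn Z f U)
    (hVU : V ⊆ U) : IsBranchOn Z f V :=
  ⟨h.1.mono hVU, fun t ht => h.2 t (hVU ht)⟩

theorem IsBranchOn.neg {Z : ℝ → ℝ → Prop} {f : ℝ → ℝ} {U : Set ℝ} (h : IsBranchOn Z f U) :
    IsBranchOn (fun t => Z (-t)) (fun t => f (-t)) (-U) :=
  ⟨fun t ht => AnalyticAt.fun_comp (h.1 (-t) ht) analyticAt_id.neg, fun t ht => h.2 (-t) ht⟩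

/-- Two branches that agree on the overlap of their domains can be glued. -/
theorem IsBranchOn.glue {Z : ℝ → ℝ → Prop} {f g : ℝ → ℝ} {U V : Set ℝ} {a b : ℝ} (hab : a < b)
    (hf : IsBranchOn Z f U) (hg : IsBranchOn Z g V) (hfg : EqOn f g (Ioo a b)) :
    ∃ h, IsBranchOn Z h (U ∩ Iio b ∪ V ∩ Ioi a) ∧ EqOn h f (Iio b) ∧ EqOn h g (Ioi a) := by
  obtain ⟨m, ham, hmb⟩ := exists_between hab
  set h : ℝ → ℝ := fun t => if t < m then f t else g t with hdef
  have h1 : EqOn h f (Iio b) := by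
    intro t ht
    by_cases htm : t < m
    · simp [hdef, htm]
    · simp only [hdef, htm, if_false]
      exact (hfg ⟨ham.trans_le (not_lt.1 htm), ht⟩).symm
  have h2 : EqOn h g (Ioi a) := by
    intro t ht
    by_cases htm : t < m
    · simp only [hdef, htm, if_true]
      exact hfg ⟨ht, htm.trans hmb⟩
    · simp [hdef, htm]
  refine ⟨h, ⟨?_, ?_⟩, h1, h2⟩
  · rintro t (⟨htU, ht⟩ | ⟨htV, ht⟩)
    · exact (hf.1 t htU).congr ((h1.eventuallyEq_of_mem (Iio_mem_nhds ht)).symm)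
    · exact (hg.1 t htV).congr ((h2.eventuallyEq_of_mem (Ioi_mem_nhds ht)).symm)
  · rintro t (⟨htU, ht⟩ | ⟨htV, ht⟩)
    · rw [h1 ht]; exact hf.2 t htU
    · rw [h2 ht]; exact hg.2 t htV

/-- Near every `t₀`, the relation `Z` has a countable family of analytic branches, which exhausts
it off `t₀`. -/
def HasLocalBranches (Z : ℝ → ℝ → Prop) : Prop :=
  ∀ t₀, ∃ ε > 0, ∃ S : Set (ℝ → ℝ), S.Countable ∧
    (∀ θ ∈ S, IsBranchOn Z θ (Ioo (t₀ - ε) (t₀ + ε))) ∧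
    ∀ t ∈ Ioo (t₀ - ε) (t₀ + ε), t ≠ t₀ → ∀ x, Z t x → ∃ θ ∈ S, x = θ t

theorem HasLocalBranches.neg {Z : ℝ → ℝ → Prop} (h : HasLocalBranches Z) :
    HasLocalBranches fun t => Z (-t) := by
  intro t₀
  obtain ⟨ε, hε, S, hS, h1, h2⟩ := h (-t₀)
  have hmem : ∀ t ∈ Ioo (t₀ - ε) (t₀ + ε), -t ∈ Ioo (-t₀ - ε) (-t₀ + ε) := fun t ht =>
    ⟨by linarith [ht.2], by linarith [ht.1]⟩
  refine ⟨ε, hε, (fun θ t => θ (-t)) '' S, hS.image _, ?_, ?_⟩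
  · rintro _ ⟨θ, hθ, rfl⟩
    exact (h1 θ hθ).neg.mono hmem
  · intro t ht htn x hx
    obtain ⟨θ, hθ, h3⟩ := h2 (-t) (hmem t ht) (fun h => htn (neg_injective h)) x hx
    exact ⟨_, ⟨θ, hθ, rfl⟩, h3⟩

/-- A continuation stopping at a finite supremum `s` agrees, on an interval just left of `s`, with
one of the countably many local branches at `s`. Gluing the two passes beyond `s`. The local family
need not be exhaustive at `s` itself, since the overlap lies strictly to the left. -/
theorem HasLocalBranches.exists_extension {Z : ℝ → ℝ → Prop} (hZ : HasLocalBranches Z)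
    {f : ℝ → ℝ} {a b : ℝ} (hab : a < b) (hf : IsBranchOn Z f (Ioo a b)) (T : ℝ) :
    ∃ g, IsBranchOn Z g (Ioo a T) ∧ EqOn f g (Ioo a b) := by
  set A : Set ℝ := {T | ∃ g, IsBranchOn Z g (Ioo a T) ∧ EqOn f g (Ioo a b)} with hA
  have hbA : b ∈ A := ⟨f, hf, fun _ _ => rfl⟩
  by_contra hT
  have hbdd : BddAbove A := by
    refine ⟨T, fun T' hT' => ?_⟩
    by_contra! hlt
    obtain ⟨g, hg, hfg⟩ := hT'
    exact hT ⟨g, hg.mono (Ioo_subset_Ioo_right hlt.le), hfg⟩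
  obtain ⟨ε, hε, S, hS, h1, h2⟩ := hZ (sSup A)
  set s := sSup A with hs
  have hbs : b ≤ s := le_csSup hbdd hbA
  obtain ⟨T', hT'A, hT'⟩ : ∃ T' ∈ A, max b (s - ε / 2) ≤ T' ∨ b = s := by
    rcases hbs.eq_or_lt with h | h
    · exact ⟨b, hbA, Or.inr h⟩
    · obtain ⟨T', h3, h4⟩ := exists_lt_of_lt_csSup ⟨b, hbA⟩
        (max_lt h (by linarith : s - ε / 2 < s))
      exact ⟨T', h3, Or.inl h4.le⟩
  obtain ⟨T'', hT''A, hbT, hsT⟩ : ∃ T'' ∈ A, b ≤ T'' ∧ s - ε < T'' := by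
    rcases hT' with h | h
    · exact ⟨T', hT'A, (le_max_left _ _).trans h, by
        linarith [(le_max_right b (s - ε / 2)).trans h]⟩
    · exact ⟨b, hbA, le_rfl, by linarith⟩
  have hTs : T'' ≤ s := le_csSup hbdd hT''A
  obtain ⟨g, hg, hfg⟩ := hT''A
  have hlt : max a (s - ε) < T'' := max_lt (hab.trans_le hbT) hsT
  have hsub1 : Ioo (max a (s - ε)) T'' ⊆ Ioo a T'' := Ioo_subset_Ioo_left (le_max_left _ _)
  have hsub2 : Ioo (max a (s - ε)) T'' ⊆ Ioo (s - ε) (s + ε) :=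
    Ioo_subset_Ioo (le_max_right _ _) (by linarith)
  obtain ⟨θ, hθ, hgθ⟩ := exists_eqOn_of_countable_cover hS hlt (hg.1.mono hsub1)
    (fun θ hθ => (h1 θ hθ).1.mono hsub2)
    (fun t ht => h2 t (hsub2 ht) (ht.2.trans_le hTs).ne _ (hg.2 t (hsub1 ht)))
  obtain ⟨h, hh, hhg, -⟩ := hg.glue hlt (h1 θ hθ) hgθ
  have : s + ε ∈ A := by
    refine ⟨h, hh.mono fun t ht => ?_, fun t ht => ?_⟩
    · rcases lt_or_ge t T'' with h3 | h3
      · exact Or.inl ⟨⟨ht.1, h3⟩, h3⟩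
      · exact Or.inr ⟨⟨by linarith, ht.2⟩, hlt.trans_le h3⟩
    · rw [hhg (ht.2.trans_le hbT), hfg ht]
  linarith [le_csSup hbdd this]

/-- The extensions to `b + n` all agree with `f` on `(a, b)`, so the identity theorem makes them
compatible and they define one function. -/
theorem HasLocalBranches.exists_extension_Ioi {Z : ℝ → ℝ → Prop} (hZ : HasLocalBranches Z)
    {f : ℝ → ℝ} {a b : ℝ} (hab : a < b) (hf : IsBranchOn Z f (Ioo a b)) :
    ∃ g, IsBranchOn Z g (Ioi a) ∧ EqOn f g (Ioo a b) := by
  choose g hg hfg using fun n : ℕ => hZ.exists_extension hab hf (b + n)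
  have hcons : ∀ m n : ℕ, m ≤ n → EqOn (g m) (g n) (Ioo a (b + m)) := by
    intro m n hmn
    have hmn' : (m : ℝ) ≤ n := by exact_mod_cast hmn
    obtain ⟨c, hac, hcb⟩ := exists_between hab
    refine (hg m).1.eqOn_of_preconnected_of_eventuallyEq
      ((hg n).1.mono (Ioo_subset_Ioo_right (by linarith))) isPreconnected_Ioo
      (z₀ := c) ⟨hac, by have := m.cast_nonneg (α := ℝ); linarith⟩ ?_
    filter_upwards [Ioo_mem_nhds hac hcb] with t ht
    rw [← hfg m ht, hfg n ht]
  set F : ℝ → ℝ := fun t => g (⌊t - b⌋₊ + 1) t with hF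
  have hFg : ∀ n : ℕ, EqOn F (g n) (Ioo a (b + n)) := by
    intro n t ht
    have h1 : t ∈ Ioo a (b + (⌊t - b⌋₊ + 1 : ℕ)) :=
      ⟨ht.1, by push_cast; linarith [Nat.lt_floor_add_one (t - b)]⟩
    rcases le_total n (⌊t - b⌋₊ + 1) with h | h
    · exact (hcons _ _ h ht).symm
    · exact hcons _ _ h h1
  have hex : ∀ t ∈ Ioi a, ∃ n : ℕ, t ∈ Ioo a (b + n) := fun t ht =>
    ⟨⌊t - b⌋₊ + 1, ht, by push_cast; linarith [Nat.lt_floor_add_one (t - b)]⟩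
  refine ⟨F, ⟨fun t ht => ?_, fun t ht => ?_⟩, fun t ht => ?_⟩
  · obtain ⟨n, hn⟩ := hex t ht
    exact ((hg n).1 t hn).congr ((hFg n).eventuallyEq_of_mem (Ioo_mem_nhds hn.1 hn.2)).symm
  · obtain ⟨n, hn⟩ := hex t ht
    rw [hFg n hn]
    exact (hg n).2 t hn
  · rw [hFg 0 (by simpa using ht), hfg 0 ht]

/-- A branch over an interval extends to a branch over the real line. -/
theorem HasLocalBranches.exists_extension_univ {Z : ℝ → ℝ → Prop} (hZ : HasLocalBranches Z)
    {f : ℝ → ℝ} {a b : ℝ} (hab : a < b) (hf : IsBranchOn Z f (Ioo a b)) :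
    ∃ g, IsBranchOn Z g univ ∧ EqOn f g (Ioo a b) := by
  obtain ⟨g, hg, hfg⟩ := hZ.exists_extension_Ioi hab hf
  have hf' : IsBranchOn (fun t => Z (-t)) (fun t => f (-t)) (Ioo (-b) (-a)) :=
    hf.neg.mono fun t ht => ⟨by linarith [ht.2], by linarith [ht.1]⟩
  obtain ⟨k, hk, hfk⟩ := hZ.neg.exists_extension_Ioi (neg_lt_neg hab) hf'
  have hk' : IsBranchOn Z (fun t => k (-t)) (Iio b) := by
    have := hk.neg.mono (V := Iio b) fun t (ht : t < b) => neg_lt_neg ht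
    simpa only [neg_neg] using this
  have hfk' : EqOn (fun t => k (-t)) f (Ioo a b) := by
    intro t ht
    have := hfk (x := -t) ⟨neg_lt_neg ht.2, neg_lt_neg ht.1⟩
    simpa using this.symm
  obtain ⟨h, hh, hhk, hhg⟩ := hk'.glue hab hg (hfk'.trans hfg)
  refine ⟨h, hh.mono fun t _ => ?_, fun t ht => ?_⟩
  · rcases lt_or_ge t b with h1 | h1
    · exact Or.inl ⟨h1, h1⟩
    · exact Or.inr ⟨hab.trans_le h1, hab.trans_le h1⟩
  · rw [hhg ht.1, hfg ht]

/-! ### Global branches: finiteness and periodicity -/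

theorem circ_eq_circ_iff {x y : ℝ} : circ x = circ y ↔ ∃ k : ℤ, x = y + 2 * Real.pi * k := by
  rw [circ, circ, Complex.exp_eq_exp_iff_exists_int]
  refine exists_congr fun k => ?_
  have h : (y : ℂ) * Complex.I + k * (2 * Real.pi * Complex.I) =
      ((y + 2 * Real.pi * k : ℝ) : ℂ) * Complex.I := by
    push_cast; ring
  rw [h, mul_left_inj' Complex.I_ne_zero, Complex.ofReal_inj]

theorem circ_add_two_pi_mul (x : ℝ) (k : ℤ) : circ (x + 2 * Real.pi * k) = circ x :=
  circ_eq_circ_iff.2 ⟨k, rfl⟩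

theorem exists_circ_eq {w : ℂ} (hw : ‖w‖ = 1) : ∃ t : ℝ, circ t = w := by
  refine ⟨w.arg, ?_⟩
  have := Complex.norm_mul_exp_arg_mul_I w
  rwa [hw, Complex.ofReal_one, one_mul] at this

theorem exists_local_branchesOn {G : ℂ[X][X]} (hG : G ≠ 0)
    (hT : ∀ w, ‖w‖ = 1 → ∀ z, (slice G w).IsRoot z → ‖z‖ = 1 ∨ slice G w = 0) (t₀ : ℝ) :
    ∃ ε > 0, ∃ l : List (ℝ → ℝ),
      (∀ θ ∈ l, IsBranchOn (fun t x => (slice G (circ t)).IsRoot (circ x)) θ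
        (Ioo (t₀ - ε) (t₀ + ε))) ∧
      ∀ t ∈ Ioo (t₀ - ε) (t₀ + ε), (t ≠ t₀ → slice G (circ t) ≠ 0) ∧
        (slice G (circ t) ≠ 0 → ∀ x, (slice G (circ t)).IsRoot (circ x) →
          ∃ θ ∈ l, ∃ k : ℤ, x = θ t + 2 * Real.pi * k) := by
  obtain ⟨l, hl, h⟩ := exists_local_branches hG hT t₀
  have h1 : ∀ᶠ t in 𝓝 t₀, ∀ θ ∈ l, AnalyticAt ℝ θ t :=
    (eventually_all_finite l.finite_toSet).2 fun θ hθ => (hl θ hθ).eventually_analyticAt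
  obtain ⟨ε, hε, hsub⟩ := Metric.eventually_nhds_iff_ball.1 (h.and h1)
  rw [Real.ball_eq_Ioo] at hsub
  refine ⟨ε, hε, l, fun θ hθ => ⟨fun t ht => (hsub t ht).2 θ hθ, fun t ht =>
    (hsub t ht).1.1 θ hθ⟩, fun t ht => ⟨(hsub t ht).1.2.1, fun h0 x hx => ?_⟩⟩
  obtain ⟨θ, hθ, h2⟩ := (hsub t ht).1.2.2 h0 _ hx
  exact ⟨θ, hθ, circ_eq_circ_iff.1 h2⟩

/-- The functions that differ from one in `l` by a multiple of `2π`. -/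
def shifts (l : List (ℝ → ℝ)) : Set (ℝ → ℝ) :=
  ⋃ k : ℤ, (fun θ t => θ t + 2 * Real.pi * k) '' {θ | θ ∈ l}

theorem countable_shifts (l : List (ℝ → ℝ)) : (shifts l).Countable :=
  countable_iUnion fun _ => (l.finite_toSet.countable).image _

theorem mem_shifts {l : List (ℝ → ℝ)} {f : ℝ → ℝ} :
    f ∈ shifts l ↔ ∃ θ ∈ l, ∃ k : ℤ, f = fun t => θ t + 2 * Real.pi * k := by
  simp only [shifts, mem_iUnion, mem_image, mem_ofPred_eq]
  constructor
  · rintro ⟨k, θ, hθ, rfl⟩; exact ⟨θ, hθ, k, rfl⟩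
  · rintro ⟨θ, hθ, k, rfl⟩; exact ⟨k, θ, hθ, rfl⟩

theorem IsBranchOn.add_two_pi_mul {G : ℂ[X][X]} {θ : ℝ → ℝ} {U : Set ℝ}
    (h : IsBranchOn (fun t x => (slice G (circ t)).IsRoot (circ x)) θ U) (k : ℤ) :
    IsBranchOn (fun t x => (slice G (circ t)).IsRoot (circ x)) (fun t => θ t + 2 * Real.pi * k) U :=
  ⟨fun t ht => (h.1 t ht).add analyticAt_const, fun t ht => by
    simpa only [circ_add_two_pi_mul] using h.2 t ht⟩

theorem IsBranchOn.comp_add_two_pi_mul {G : ℂ[X][X]} {θ : ℝ → ℝ}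
    (h : IsBranchOn (fun t x => (slice G (circ t)).IsRoot (circ x)) θ univ) (k : ℤ) :
    IsBranchOn (fun t x => (slice G (circ t)).IsRoot (circ x))
      (fun t => θ (t + 2 * Real.pi * k)) univ :=
  ⟨fun t _ => AnalyticAt.fun_comp (h.1 _ trivial) (analyticAt_id.add analyticAt_const),
    fun t _ => by simpa only [circ_add_two_pi_mul] using h.2 (t + 2 * Real.pi * k) trivial⟩

theorem hasLocalBranches {G : ℂ[X][X]} (hG : G ≠ 0)
    (hT : ∀ w, ‖w‖ = 1 → ∀ z, (slice G w).IsRoot z → ‖z‖ = 1 ∨ slice G w = 0) :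
    HasLocalBranches fun t x => (slice G (circ t)).IsRoot (circ x) := by
  intro t₀
  obtain ⟨ε, hε, l, h1, h2⟩ := exists_local_branchesOn hG hT t₀
  refine ⟨ε, hε, shifts l, countable_shifts l, ?_, ?_⟩
  · intro f hf
    obtain ⟨θ, hθ, k, rfl⟩ := mem_shifts.1 hf
    exact (h1 θ hθ).add_two_pi_mul k
  · intro t ht htn x hx
    obtain ⟨θ, hθ, k, h3⟩ := (h2 t ht).2 ((h2 t ht).1 htn) x hx
    exact ⟨_, mem_shifts.2 ⟨θ, hθ, k, rfl⟩, h3⟩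

/-- Up to multiples of `2π`, there are finitely many branches over the real line. -/
theorem exists_finite_branches {G : ℂ[X][X]} (hG : G ≠ 0)
    (hT : ∀ w, ‖w‖ = 1 → ∀ z, (slice G w).IsRoot z → ‖z‖ = 1 ∨ slice G w = 0) :
    ∃ L : Set (ℝ → ℝ), L.Finite ∧
      ∀ f, IsBranchOn (fun t x => (slice G (circ t)).IsRoot (circ x)) f univ →
        ∃ g ∈ L, ∃ k : ℤ, ∀ t, f t = g t + 2 * Real.pi * k := by
  obtain ⟨ε, hε, l, h1, h2⟩ := exists_local_branchesOn hG hT 0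
  -- The center `0` is left out because the slice there may vanish identically. Each global branch
  -- is determined by its restriction to `(0, ε)`.
  have hsub : Ioo 0 ε ⊆ Ioo (0 - ε) (0 + ε) := fun t ht => ⟨by linarith [ht.1], by linarith [ht.2]⟩
  choose! F hF hθF using fun θ (hθ : θ ∈ l) =>
    (hasLocalBranches hG hT).exists_extension_univ hε ((h1 θ hθ).mono hsub)
  refine ⟨F '' {θ | θ ∈ l}, l.finite_toSet.image _, fun f hf => ?_⟩
  obtain ⟨ψ, hψ, h3⟩ := exists_eqOn_of_countable_cover (countable_shifts l) hε
    (hf.1.mono (subset_univ _)) (fun ψ hψ => by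
      obtain ⟨θ, hθ, k, rfl⟩ := mem_shifts.1 hψ
      exact (((h1 θ hθ).mono hsub).add_two_pi_mul k).1)
    (fun t ht => by
      obtain ⟨θ, hθ, k, h4⟩ := (h2 t (hsub ht)).2 ((h2 t (hsub ht)).1 ht.1.ne') (f t) (hf.2 t trivial)
      exact ⟨_, mem_shifts.2 ⟨θ, hθ, k, rfl⟩, h4⟩)
  obtain ⟨θ, hθ, k, rfl⟩ := mem_shifts.1 hψ
  refine ⟨F θ, ⟨θ, hθ, rfl⟩, k, fun t => ?_⟩
  refine hf.1.eqOn_of_preconnected_of_eventuallyEq ((hF θ hθ).add_two_pi_mul k).1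
    isPreconnected_univ (z₀ := ε / 2) trivial ?_ (mem_univ t)
  filter_upwards [Ioo_mem_nhds (by linarith : (0 : ℝ) < ε / 2) (by linarith : ε / 2 < ε)] with s hs
  rw [h3 hs, ← hθF θ hθ hs]

/-- The translates of `f` by `2πn` are again branches. Only finitely many classes modulo `2π` exist,
so two translates differ by a constant multiple of `2π`. -/
theorem exists_period {G : ℂ[X][X]} (hG : G ≠ 0)
    (hT : ∀ w, ‖w‖ = 1 → ∀ z, (slice G w).IsRoot z → ‖z‖ = 1 ∨ slice G w = 0) {f : ℝ → ℝ}
    (hf : IsBranchOn (fun t x => (slice G (circ t)).IsRoot (circ x)) f univ) :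
    ∃ k : ℕ, 0 < k ∧ ∃ m : ℤ, ∀ t, f (t + 2 * Real.pi * k) = f t + 2 * Real.pi * m := by
  obtain ⟨L, hL, h⟩ := exists_finite_branches hG hT
  choose g hgL m hm using fun n : ℕ => h _ (hf.comp_add_two_pi_mul n)
  have : Finite L := hL
  obtain ⟨i, j, hij, hg⟩ := Finite.exists_ne_map_eq_of_infinite fun n => (⟨g n, hgL n⟩ : L)
  wlog hlt : i < j generalizing i j
  · exact this j i hij.symm hg.symm (lt_of_le_of_ne (not_lt.1 hlt) hij.symm)
  have hg' : g i = g j := congrArg Subtype.val hg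
  refine ⟨j - i, Nat.sub_pos_of_lt hlt, m j - m i, fun t => ?_⟩
  have h1 := hm i (t - 2 * Real.pi * i)
  have h2 := hm j (t - 2 * Real.pi * i)
  rw [hg'] at h1
  simp only [Int.cast_natCast, sub_add_cancel] at h1 h2
  rw [Nat.cast_sub hlt.le]
  have h3 : t + 2 * Real.pi * ((j : ℝ) - i) = t - 2 * Real.pi * i + 2 * Real.pi * j := by ring
  rw [h3, h2, h1]
  push_cast
  ring

/-! ### Intersections of the curves -/

theorem eq_of_infinite_eq {φ ψ : ℝ → ℂ} (hφ : AnalyticOnNhd ℝ φ univ) (hψ : AnalyticOnNhd ℝ ψ univ)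
    {a b : ℝ} (h : {t ∈ Icc a b | φ t = ψ t}.Infinite) : φ = ψ := by
  obtain ⟨x, -, hx⟩ := h.exists_accPt_of_subset_isCompact isCompact_Icc (sep_subset _ _)
  have h1 : ∃ᶠ t in 𝓝[≠] x, φ t = ψ t := (accPt_iff_frequently_nhdsNE.1 hx).mono fun t ht => ht.2
  funext t
  exact hφ.eqOn_of_preconnected_of_frequently_eq hψ isPreconnected_univ (mem_univ x) h1 (mem_univ t)

/-- The closed curve traced out by `t ↦ (e^{i f(t)}, e^{it})`. -/
def graphCurve (f : ℝ → ℝ) : Set C2 := range fun t : ℝ => torusPoint (f t) t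

theorem torusPoint_eq_iff {s t s' t' : ℝ} :
    torusPoint s t = torusPoint s' t' ↔ circ s = circ s' ∧ circ t = circ t' := by
  constructor
  · intro h
    exact ⟨congrFun h 0, congrFun h 1⟩
  · rintro ⟨h1, h2⟩
    show ![circ s, circ t] = ![circ s', circ t']
    rw [h1, h2]

theorem periodic_torusPoint {f : ℝ → ℝ} {k : ℕ} {m : ℤ}
    (h : ∀ t, f (t + 2 * Real.pi * k) = f t + 2 * Real.pi * m) :
    Function.Periodic (fun t => torusPoint (f t) t) (2 * Real.pi * k) := by
  intro t
  refine torusPoint_eq_iff.2 ⟨?_, ?_⟩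
  · rw [h, circ_add_two_pi_mul]
  · exact_mod_cast circ_add_two_pi_mul t k

/-- Over a common point the parameters differ by `2πj`. Periodicity confines `t` to one period of
`f` and `j` to residues modulo `k'`, so a single residue accounts for infinitely many coincidences,
and the identity theorem applies to the circle-valued functions. -/
theorem graphCurve_eq_of_infinite_inter {f g : ℝ → ℝ} (hf : AnalyticOnNhd ℝ f univ)
    (hg : AnalyticOnNhd ℝ g univ) {k k' : ℕ} (hk : 0 < k) (hk' : 0 < k') {m m' : ℤ}
    (hfk : ∀ t, f (t + 2 * Real.pi * k) = f t + 2 * Real.pi * m)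
    (hgk : ∀ t, g (t + 2 * Real.pi * k') = g t + 2 * Real.pi * m')
    (h : (graphCurve f ∩ graphCurve g).Infinite) : graphCurve f = graphCurve g := by
  have hpos : 0 < 2 * Real.pi * k := by have := Real.pi_pos; positivity
  have hsub : graphCurve f ∩ graphCurve g ⊆ ⋃ a ∈ Ico (0 : ℤ) k', (fun t => torusPoint (f t) t) ''
      {t ∈ Icc 0 (2 * Real.pi * k) | circ (f t) = circ (g (t + 2 * Real.pi * a))} := by
    rintro _ ⟨⟨t, rfl⟩, ⟨s, hs⟩⟩
    obtain ⟨t', ht', htt'⟩ := (periodic_torusPoint hfk).exists_mem_Ico₀ hpos t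
    simp only at hs htt'
    show torusPoint (f t) t ∈ _
    rw [htt'] at hs ⊢
    obtain ⟨h1, h2⟩ := torusPoint_eq_iff.1 hs
    obtain ⟨j, rfl⟩ := circ_eq_circ_iff.1 h2
    have hk0 : (k' : ℤ) ≠ 0 := by exact_mod_cast hk'.ne'
    refine mem_biUnion (x := j % k') ⟨Int.emod_nonneg _ hk0, Int.emod_lt_of_pos _ (by exact_mod_cast hk')⟩
      ⟨t', ⟨Ico_subset_Icc_self ht', ?_⟩, rfl⟩
    have h3 := (periodic_torusPoint hgk).int_mul (j / k') (t' + 2 * Real.pi * (j % k' : ℤ))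
    have h4 : t' + 2 * Real.pi * (j % k' : ℤ) + (j / k' : ℤ) * (2 * Real.pi * k') =
        t' + 2 * Real.pi * j := by
      have : (j : ℝ) = (j % k' : ℤ) + k' * (j / k' : ℤ) := by
        exact_mod_cast (Int.emod_add_mul_ediv j k').symm
      rw [this]; ring
    rw [h4] at h3
    rw [← h1]
    exact (torusPoint_eq_iff.1 h3).1
  obtain ⟨a, -, ha⟩ : ∃ a ∈ Ico (0 : ℤ) k',
      ((fun t => torusPoint (f t) t) '' {t ∈ Icc 0 (2 * Real.pi * k) |
        circ (f t) = circ (g (t + 2 * Real.pi * a))}).Infinite := by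
    by_contra! hfin
    exact h (((finite_Ico _ _).biUnion hfin).subset hsub)
  have heq := eq_of_infinite_eq
    (fun t _ => AnalyticAt.fun_comp (analyticAt_circ _) (hf t trivial))
    (fun t _ => AnalyticAt.fun_comp (analyticAt_circ _)
      (AnalyticAt.fun_comp (hg (t + 2 * Real.pi * a) trivial) (analyticAt_id.add analyticAt_const)))
    ha.of_image
  ext z
  constructor
  · rintro ⟨t, rfl⟩
    exact ⟨t + 2 * Real.pi * a, torusPoint_eq_iff.2
      ⟨(congrFun heq t).symm, circ_add_two_pi_mul _ _⟩⟩
  · rintro ⟨t, rfl⟩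
    refine ⟨t - 2 * Real.pi * a, torusPoint_eq_iff.2 ⟨?_, ?_⟩⟩
    · rw [congrFun heq (t - 2 * Real.pi * a), sub_add_cancel]
    · rw [← circ_add_two_pi_mul _ a, sub_add_cancel]

theorem finite_graphCurve_inter_fiber {f : ℝ → ℝ} {k : ℕ} (hk : 0 < k) {m : ℤ}
    (hfk : ∀ t, f (t + 2 * Real.pi * k) = f t + 2 * Real.pi * m) (w : ℂ) :
    (graphCurve f ∩ {z | z 1 = w}).Finite := by
  have hpos : 0 < 2 * Real.pi * k := by have := Real.pi_pos; positivity
  have hfin : {t ∈ Icc 0 (2 * Real.pi * k) | circ t = w}.Finite := by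
    by_contra hinf
    have h1 := eq_of_infinite_eq (φ := circ) (ψ := fun _ => w) (fun t _ => analyticAt_circ t)
      analyticOnNhd_const hinf
    have h2 : circ 0 = circ Real.pi := (congrFun h1 0).trans (congrFun h1 Real.pi).symm
    simp [circ] at h2
    norm_num at h2
  refine (hfin.image fun t => torusPoint (f t) t).subset ?_
  rintro _ ⟨⟨t, rfl⟩, hw⟩
  obtain ⟨t', ht', htt'⟩ := (periodic_torusPoint hfk).exists_mem_Ico₀ hpos t
  refine ⟨t', ⟨Ico_subset_Icc_self ht', ?_⟩, htt'.symm⟩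
  rw [← (torusPoint_eq_iff.1 htt').2]
  exact hw

/-! ### Decomposition of the zero set on the torus -/

/-- The zeros on the 2-torus of a polynomial all of whose slices over points of the unit circle
either vanish or have all their zeros on the unit circle. -/
theorem exists_curve_decomposition {G : ℂ[X][X]} (hG : G ≠ 0)
    (hT : ∀ w, ‖w‖ = 1 → ∀ z, (slice G w).IsRoot z → ‖z‖ = 1 ∨ slice G w = 0) :
    ∃ 𝒞 : Set (Set C2), 𝒞.Finite ∧
      {z | z ∈ torus ∧ (slice G (z 1)).IsRoot (z 0)} = ⋃₀ 𝒞 ∧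
      (∀ K ∈ 𝒞, IsClosedAnalyticGraph K ∨ IsTorusFiber K) ∧
      (∀ K ∈ 𝒞, ∀ L ∈ 𝒞, K ≠ L → (K ∩ L).Finite) := by
  set B : Set (ℝ → ℝ) :=
    {f | IsBranchOn (fun t x => (slice G (circ t)).IsRoot (circ x)) f univ} with hB
  set W : Set ℂ := {w | ‖w‖ = 1 ∧ slice G w = 0} with hW
  set fib : ℂ → Set C2 := fun w => range fun s : ℝ => ![circ s, w] with hfib
  have hfib1 : ∀ w, fib w ⊆ {z | z 1 = w} := by
    rintro w _ ⟨s, rfl⟩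
    rfl
  have hWfin : W.Finite := by
    refine (Polynomial.finite_setOfPred_isRoot (Polynomial.leadingCoeff_ne_zero.2 hG)).subset ?_
    rintro w ⟨-, hw⟩
    show Polynomial.eval w G.leadingCoeff = 0
    rw [Polynomial.leadingCoeff, ← coeff_slice, hw, Polynomial.coeff_zero]
  obtain ⟨L, hL, hLB⟩ := exists_finite_branches hG hT
  refine ⟨graphCurve '' B ∪ fib '' W, (Finite.subset (hL.image graphCurve) ?_).union
    (hWfin.image _), ?_, ?_, ?_⟩
  · rintro _ ⟨f, hf, rfl⟩
    obtain ⟨g, hg, k, hk⟩ := hLB f hf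
    refine ⟨g, hg, ?_⟩
    have : (fun t => torusPoint (f t) t) = fun t => torusPoint (g t) t := by
      funext t
      exact torusPoint_eq_iff.2 ⟨by rw [hk, circ_add_two_pi_mul], rfl⟩
    rw [graphCurve, graphCurve, this]
  · ext z
    constructor
    · rintro ⟨hz, hroot⟩
      obtain ⟨x, hx⟩ := exists_circ_eq (hz 0)
      obtain ⟨t, ht⟩ := exists_circ_eq (hz 1)
      have hzp : z = ![circ x, circ t] := by
        ext i; fin_cases i
        · exact hx.symm
        · exact ht.symm
      -- A vanishing slice puts the point on a fiber. Otherwise the point lies on a local branch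
      -- centered at its own parameter, which continues to a global one.
      by_cases h0 : slice G (z 1) = 0
      · exact ⟨fib (z 1), Or.inr ⟨z 1, ⟨hz 1, h0⟩, rfl⟩, x, by rw [hzp]; rfl⟩
      · rw [← ht] at h0 hroot
        rw [← hx] at hroot
        obtain ⟨ε, hε, l, h1, h2⟩ := exists_local_branchesOn hG hT t
        have htm : t ∈ Ioo (t - ε) (t + ε) := ⟨by linarith, by linarith⟩
        obtain ⟨θ, hθ, k, hk⟩ := (h2 t htm).2 h0 x hroot
        obtain ⟨g, hg, hθg⟩ := (hasLocalBranches hG hT).exists_extension_univ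
          (by linarith) (h1 θ hθ)
        refine ⟨graphCurve g, Or.inl ⟨g, hg, rfl⟩, t, ?_⟩
        rw [hzp]
        refine torusPoint_eq_iff.2 ⟨?_, rfl⟩
        rw [hk, circ_add_two_pi_mul, hθg htm]
    · rintro ⟨_, ⟨f, hf, rfl⟩ | ⟨w, ⟨hw1, hw⟩, rfl⟩, t, rfl⟩
      · refine ⟨fun i => ?_, hf.2 t trivial⟩
        fin_cases i
        · exact norm_circ _
        · exact norm_circ _
      · refine ⟨fun i => ?_, ?_⟩
        · fin_cases i
          · exact norm_circ _
          · exact hw1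
        · show (slice G w).IsRoot (circ t)
          rw [hw]
          simp
  · rintro _ (⟨f, hf, rfl⟩ | ⟨w, ⟨hw1, hw⟩, rfl⟩)
    · exact Or.inl ⟨f, hf.1, exists_period hG hT hf, rfl⟩
    · obtain ⟨t, rfl⟩ := exists_circ_eq hw1
      exact Or.inr ⟨t, rfl⟩
  · rintro _ (⟨f, hf, rfl⟩ | ⟨w, hw, rfl⟩) _ (⟨g, hg, rfl⟩ | ⟨w', hw', rfl⟩) hne
    · obtain ⟨k, hk, m, hm⟩ := exists_period hG hT hf
      obtain ⟨k', hk', m', hm'⟩ := exists_period hG hT hg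
      by_contra hinf
      exact hne (graphCurve_eq_of_infinite_inter hf.1 hg.1 hk hk' hm hm' hinf)
    · obtain ⟨k, hk, m, hm⟩ := exists_period hG hT hf
      exact (finite_graphCurve_inter_fiber hk hm w').subset (inter_subset_inter_right _ (hfib1 w'))
    · obtain ⟨k, hk, m, hm⟩ := exists_period hG hT hg
      rw [inter_comm]
      exact (finite_graphCurve_inter_fiber hk hm w).subset (inter_subset_inter_right _ (hfib1 w))
    · refine finite_empty.subset fun z hz => hne ?_
      rw [← hfib1 w hz.1, ← hfib1 w' hz.2]

/-! ### Boundedness of rational inner functions -/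

/-- A polynomial in `z₁, z₂` as a polynomial in `z₁` with coefficients that are polynomials
in `z₂`. -/
def toBivariate : Poly2 →ₐ[ℂ] ℂ[X][X] := aeval ![Polynomial.X, Polynomial.C Polynomial.X]

theorem eval_slice_toBivariate (F : Poly2) (z w : ℂ) :
    (slice (toBivariate F) w).eval z = eval ![z, w] F := by
  induction F using MvPolynomial.induction_on with
  | C a => simp [slice, toBivariate, Polynomial.algebraMap_apply]
  | add p q hp hq => simp only [slice, map_add, Polynomial.map_add, Polynomial.eval_add] at *; rw [hp, hq]
  | mul_X p i hp =>
    simp only [slice, map_mul, Polynomial.map_mul, Polynomial.eval_mul] at *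
    rw [hp]
    congr 1
    fin_cases i <;> simp [toBivariate]

theorem bidisk_eq_ball : bidisk = Metric.ball (0 : C2) 1 := by
  ext z
  simp [bidisk, pi_norm_lt_iff]

theorem differentiable_eval (p : Poly2) : Differentiable ℂ fun z : C2 => eval z p := by
  simp only [eval_eq']
  fun_prop

/-- The reflection of the polynomial `z ↦ p (r z)`. -/
def dilatedReflection (p : Poly2) (r : ℂ) (z : C2) : ℂ :=
  ∑ s ∈ p.support, starRingEnd ℂ (coeff s p) * r ^ (s 0 + s 1) *
    (z 0 ^ (p.degreeOf 0 - s 0) * z 1 ^ (p.degreeOf 1 - s 1))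

theorem dilatedReflection_one (p : Poly2) (z : C2) :
    dilatedReflection p 1 z = eval z (reflection p) := by
  rw [dilatedReflection, reflection, map_sum]
  refine Finset.sum_congr rfl fun s _ => ?_
  rw [eval_monomial, Finsupp.prod_fintype _ _ (by simp)]
  simp [bidegree]

/-- On the torus `1 / conj z = z`, so the reflection of the dilate is a unimodular monomial times
the conjugate of `p (r z)`. -/
theorem norm_dilatedReflection {p : Poly2} {r : ℝ} {z : C2} (hz : ∀ i, ‖z i‖ = 1) :
    ‖dilatedReflection p r z‖ = ‖eval (fun i => r * z i) p‖ := by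
  have hzz : ∀ i, z i * starRingEnd ℂ (z i) = 1 := fun i => by
    rw [Complex.mul_conj, Complex.normSq_eq_norm_sq, hz]; simp
  have h : dilatedReflection p r z = z 0 ^ p.degreeOf 0 * z 1 ^ p.degreeOf 1 *
      starRingEnd ℂ (eval (fun i => r * z i) p) := by
    rw [dilatedReflection, eval_eq', map_sum, Finset.mul_sum]
    refine Finset.sum_congr rfl fun s hs => ?_
    have h1 : ∀ i, z i ^ (p.degreeOf i - s i) =
        z i ^ p.degreeOf i * starRingEnd ℂ (z i) ^ s i := by
      intro i
      have hle : s i ≤ p.degreeOf i := monomial_le_degreeOf i hs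
      conv_rhs => rw [← Nat.sub_add_cancel hle, pow_add, mul_assoc, ← mul_pow, hzz, one_pow, mul_one]
    rw [h1, h1]
    simp only [Fin.prod_univ_two, map_mul, map_pow, Complex.conj_ofReal, mul_pow, pow_add]
    ring
  rw [h, norm_mul, norm_mul, norm_pow, norm_pow, hz, hz, Complex.norm_conj]
  simp

theorem norm_div_le_one_of_sphere {f g : ℂ → ℂ} (hf : Differentiable ℂ f) (hg : Differentiable ℂ g)
    (hg0 : ∀ z, ‖z‖ ≤ 1 → g z ≠ 0) (h : ∀ z, ‖z‖ = 1 → ‖f z‖ ≤ ‖g z‖) {z : ℂ} (hz : ‖z‖ ≤ 1) :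
    ‖f z‖ ≤ ‖g z‖ := by
  have hcl : closure (Metric.ball (0 : ℂ) 1) = Metric.closedBall 0 1 := closure_ball 0 one_ne_zero
  have h1 : DiffContOnCl ℂ (fun z => f z / g z) (Metric.ball 0 1) := by
    refine DifferentiableOn.diffContOnCl fun z hz => ?_
    rw [hcl] at hz
    exact ((hf z).div (hg z) (hg0 z (by simpa using hz))).differentiableWithinAt
  have h2 := Complex.norm_le_of_forall_mem_frontier_norm_le Metric.isBounded_ball h1 (C := 1)
    (fun z hz => by
      rw [frontier_ball _ one_ne_zero] at hz
      have hz1 : ‖z‖ = 1 := by simpa using hz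
      rw [norm_div]
      exact div_le_one_of_le₀ (h z hz1) (norm_nonneg _)) (z := z) (by rw [hcl]; simpa using hz)
  rwa [norm_div, div_le_one (norm_pos_iff.2 (hg0 z hz))] at h2

/-- For `r < 1` the dilate has no zeros on the closed bidisk, so the one-variable maximum principle
carries the equality on the torus to an inequality inside, first in `z` with `|w| = 1`, then in `w`.
-/
theorem norm_dilatedReflection_le {p : Poly2} (hp : ∀ z ∈ bidisk, eval z p ≠ 0) {r : ℝ}
    (hr0 : 0 ≤ r) (hr1 : r < 1) {z w : ℂ} (hz : ‖z‖ ≤ 1) (hw : ‖w‖ ≤ 1) :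
    ‖dilatedReflection p r ![z, w]‖ ≤ ‖eval (fun i => r * (![z, w] : C2) i) p‖ := by
  have hne : ∀ z w : ℂ, ‖z‖ ≤ 1 → ‖w‖ ≤ 1 → eval (fun i => r * (![z, w] : C2) i) p ≠ 0 := by
    intro z w hz hw
    have h1 : ∀ x : ℂ, ‖x‖ ≤ 1 → ‖(r : ℂ) * x‖ < 1 := fun x hx => by
      rw [norm_mul, Complex.norm_real, Real.norm_of_nonneg hr0]
      nlinarith [norm_nonneg x]
    refine hp _ fun i => ?_
    fin_cases i
    · exact h1 z hz
    · exact h1 w hw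
  have hd1 : ∀ w, Differentiable ℂ fun z => dilatedReflection p r ![z, w] := by
    intro w
    simp only [dilatedReflection, Matrix.cons_val_zero, Matrix.cons_val_one]
    fun_prop
  have hd2 : ∀ z, Differentiable ℂ fun w => dilatedReflection p r ![z, w] := by
    intro z
    simp only [dilatedReflection, Matrix.cons_val_zero, Matrix.cons_val_one]
    fun_prop
  have hd3 : ∀ w, Differentiable ℂ fun z => eval (fun i => r * (![z, w] : C2) i) p := by
    intro w
    refine (differentiable_eval p).comp (differentiable_pi.2 fun i => ?_)
    fin_cases i <;> simp
    fun_prop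
  have hd4 : ∀ z, Differentiable ℂ fun w => eval (fun i => r * (![z, w] : C2) i) p := by
    intro z
    refine (differentiable_eval p).comp (differentiable_pi.2 fun i => ?_)
    fin_cases i <;> simp
    fun_prop
  have h1 : ∀ w, ‖w‖ = 1 → ∀ z, ‖z‖ ≤ 1 →
      ‖dilatedReflection p r ![z, w]‖ ≤ ‖eval (fun i => r * (![z, w] : C2) i) p‖ := by
    intro w hw z hz
    refine norm_div_le_one_of_sphere (hd1 w) (hd3 w) (fun z hz => hne z w hz hw.le)
      (fun z hz => (norm_dilatedReflection fun i => ?_).le) hz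
    fin_cases i
    · exact hz
    · exact hw
  exact norm_div_le_one_of_sphere (hd2 z) (hd4 z) (fun w hw => hne z w hz hw)
    (fun w hw => h1 w hw z hz) hw

theorem eq_cons_cons (z : C2) : z = ![z 0, z 1] := by
  ext i; fin_cases i <;> rfl

/-- A rational inner function is bounded by `1` on the bidisk. -/
theorem norm_reflection_le {p : Poly2} (hp : ∀ z ∈ bidisk, eval z p ≠ 0) {z : C2}
    (hz : z ∈ bidisk) : ‖eval z (reflection p)‖ ≤ ‖eval z p‖ := by
  have h1 : ∀ᶠ r : ℝ in 𝓝[<] 1, ‖dilatedReflection p r z‖ ≤ ‖eval (fun i => r * z i) p‖ := by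
    filter_upwards [Ioo_mem_nhdsLT (zero_lt_one (α := ℝ))] with r hr
    rw [eq_cons_cons z]
    exact norm_dilatedReflection_le hp hr.1.le hr.2 (hz 0).le (hz 1).le
  have h2 : Continuous fun r : ℝ => ‖dilatedReflection p r z‖ := by
    unfold dilatedReflection
    fun_prop
  have h3 : Continuous fun r : ℝ => ‖eval (fun i => r * z i) p‖ :=
    ((MvPolynomial.continuous_eval p).comp (by fun_prop)).norm
  have h4 := le_of_tendsto_of_tendsto ((h2.tendsto 1).mono_left nhdsWithin_le_nhds)
    ((h3.tendsto 1).mono_left nhdsWithin_le_nhds) h1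
  simpa [dilatedReflection_one] using h4

namespace NormalizedRIF

/-- The polynomial `e^{iα} p̃ - p`, whose zeros are the points where `φ = 1` or `p = p̃ = 0`. -/
def levelPoly (φ : NormalizedRIF) : Poly2 := φ.num - φ.den

theorem norm_phase (φ : NormalizedRIF) : ‖Complex.exp (φ.angle * Complex.I)‖ = 1 :=
  Complex.norm_exp_ofReal_mul_I _

theorem eval_levelPoly (φ : NormalizedRIF) (z : C2) : eval z φ.levelPoly =
    Complex.exp (φ.angle * Complex.I) * eval z (reflection φ.den) - eval z φ.den := by
  simp [levelPoly, num]

theorem eval_levelPoly_eq_zero_iff (φ : NormalizedRIF) {z : C2} (hz : z ∈ bidisk) :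
    eval z φ.levelPoly = 0 ↔ φ.toFun z = 1 := by
  rw [toFun, div_eq_one_iff_eq (φ.den_ne_zero z hz), levelPoly, map_sub, sub_eq_zero]

theorem norm_toFun_le (φ : NormalizedRIF) {z : C2} (hz : z ∈ bidisk) : ‖φ.toFun z‖ ≤ 1 := by
  rw [toFun, norm_div, num, map_mul, norm_mul, eval_C, norm_phase, one_mul]
  exact div_le_one_of_le₀ (norm_reflection_le φ.den_ne_zero hz) (norm_nonneg _)

/-- The value `1` would be an interior maximum of `|φ|`, forcing `φ` to be constant. -/
theorem toFun_ne_one (φ : NormalizedRIF) (hφ : ∃ z ∈ bidisk, φ.toFun z ≠ 1) {z : C2}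
    (hz : z ∈ bidisk) : φ.toFun z ≠ 1 := by
  intro h1
  obtain ⟨w, hw, hw1⟩ := hφ
  have hd : DifferentiableOn ℂ φ.toFun (Metric.ball 0 1) := by
    have : φ.toFun = fun x => eval x φ.num * (eval x φ.den)⁻¹ := by
      ext x; rw [toFun, div_eq_mul_inv]
    rw [this]
    exact fun x hx => ((differentiable_eval φ.num x).fun_mul ((differentiable_eval φ.den x).fun_inv
      (φ.den_ne_zero x (bidisk_eq_ball ▸ hx)))).differentiableWithinAt
  have hmax : IsMaxOn (norm ∘ φ.toFun) (Metric.ball 0 1) z := by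
    intro x hx
    show ‖φ.toFun x‖ ≤ ‖φ.toFun z‖
    rw [h1, norm_one]
    exact φ.norm_toFun_le (bidisk_eq_ball ▸ hx)
  have := Complex.eqOn_of_isPreconnected_of_isMaxOn_norm
    (convex_ball (0 : C2) 1).isPreconnected Metric.isOpen_ball hd (bidisk_eq_ball ▸ hz) hmax
    (bidisk_eq_ball ▸ hw)
  exact hw1 (this.trans h1)

end NormalizedRIF

/-! ### Zeros of slices over the circle -/

/-- A Harnack-type inequality for polynomials without zeros in the unit disk. -/
theorem norm_eval_mul_le {q : ℂ[X]} (hq : ∀ z, ‖z‖ < 1 → ¬ q.IsRoot z) {N : ℕ}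
    (hN : q.natDegree ≤ N) {z ζ : ℂ} (hz : ‖z‖ < 1) (hζ : ‖ζ‖ < 1) :
    ‖q.eval ζ‖ * (1 - ‖z‖) ^ N ≤ 2 ^ N * ‖q.eval z‖ := by
  have key : ∀ s : Multiset ℂ, (∀ r ∈ s, 1 ≤ ‖r‖) →
      ‖((s.map fun a => Polynomial.X - Polynomial.C a).prod).eval ζ‖ * (1 - ‖z‖) ^ s.card ≤
        2 ^ s.card * ‖((s.map fun a => Polynomial.X - Polynomial.C a).prod).eval z‖ := by
    intro s
    induction s using Multiset.induction_on with
    | empty => simp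
    | cons a s ih =>
      intro hs
      have h1 := ih fun r hr => hs r (Multiset.mem_cons_of_mem hr)
      have ha := hs a (Multiset.mem_cons_self a s)
      -- Since `|a| ≥ 1`, the difference `2(|a| - |z|) - (1 + |a|)(1 - |z|) = (|a| - 1)(1 + |z|)` is
      -- nonnegative.
      have h2 : ‖ζ - a‖ * (1 - ‖z‖) ≤ 2 * ‖z - a‖ := by
        have h3 : ‖ζ - a‖ ≤ 1 + ‖a‖ := (norm_sub_le _ _).trans (by linarith)
        have h4 : ‖a‖ - ‖z‖ ≤ ‖z - a‖ := by rw [norm_sub_rev]; exact norm_sub_norm_le _ _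
        nlinarith [norm_nonneg z]
      simp only [Multiset.map_cons, Multiset.prod_cons, Polynomial.eval_mul, Polynomial.eval_sub,
        Polynomial.eval_X, Polynomial.eval_C, norm_mul, Multiset.card_cons, pow_succ]
      calc _ = (‖ζ - a‖ * (1 - ‖z‖)) * (‖((s.map fun a =>
            Polynomial.X - Polynomial.C a).prod).eval ζ‖ * (1 - ‖z‖) ^ s.card) := by ring
        _ ≤ (2 * ‖z - a‖) * (2 ^ s.card * ‖((s.map fun a =>
            Polynomial.X - Polynomial.C a).prod).eval z‖) := by
          refine mul_le_mul h2 h1 ?_ (by positivity)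
          exact mul_nonneg (norm_nonneg _) (pow_nonneg (by linarith) _)
        _ = _ := by ring
  by_cases hq0 : q = 0
  · simp [hq0]
  have h1 := key q.roots fun r hr => by
    by_contra! h
    exact hq r h (Polynomial.isRoot_of_mem_roots hr)
  rw [card_roots_eq] at h1
  have h2 : ∀ x, ‖q.eval x‖ = ‖q.leadingCoeff‖ *
      ‖((q.roots.map fun a => Polynomial.X - Polynomial.C a).prod).eval x‖ := fun x => by
    conv_lhs => rw [(IsAlgClosed.splits q).eq_prod_roots]
    rw [Polynomial.eval_mul, Polynomial.eval_C, norm_mul]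
  obtain ⟨d, rfl⟩ := Nat.exists_eq_add_of_le hN
  have h3 : ‖q.eval ζ‖ * (1 - ‖z‖) ^ q.natDegree ≤ 2 ^ q.natDegree * ‖q.eval z‖ := by
    rw [h2, h2]
    calc _ = ‖q.leadingCoeff‖ * _ := mul_assoc _ _ _
      _ ≤ ‖q.leadingCoeff‖ * _ := mul_le_mul_of_nonneg_left h1 (norm_nonneg _)
      _ = _ := by ring
  have h4 : (1 - ‖z‖) ^ d ≤ 2 ^ d :=
    pow_le_pow_left₀ (by linarith) (by linarith [norm_nonneg z]) d
  calc ‖q.eval ζ‖ * (1 - ‖z‖) ^ (q.natDegree + d)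
      = (‖q.eval ζ‖ * (1 - ‖z‖) ^ q.natDegree) * (1 - ‖z‖) ^ d := by ring
    _ ≤ (2 ^ q.natDegree * ‖q.eval z‖) * 2 ^ d := by
        refine mul_le_mul h3 h4 (pow_nonneg (by linarith) _) (by positivity)
    _ = _ := by ring

/-- Hurwitz's theorem for the slices of a polynomial without zeros in the bidisk. -/
theorem slice_eq_zero_of_root {F : Poly2} (hF : ∀ z ∈ bidisk, eval z F ≠ 0) {z w : ℂ}
    (hz : ‖z‖ < 1) (hw : ‖w‖ = 1) (h : (slice (toBivariate F) w).IsRoot z) :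
    slice (toBivariate F) w = 0 := by
  -- One degree bound serves all slices, so the Harnack inequality at `r w` passes to the limit `r →
  -- 1`. There the zero at `z` forces a zero at every `ζ` in the disk.
  set N := (toBivariate F).natDegree
  have key : ∀ ζ : ℂ, ‖ζ‖ < 1 → (slice (toBivariate F) w).IsRoot ζ := by
    intro ζ hζ
    have h1 : ∀ᶠ r : ℝ in 𝓝[<] 1, ‖eval ![ζ, r * w] F‖ * (1 - ‖z‖) ^ N ≤
        2 ^ N * ‖eval ![z, r * w] F‖ := by
      filter_upwards [Ioo_mem_nhdsLT (zero_lt_one (α := ℝ))] with r hr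
      rw [← eval_slice_toBivariate, ← eval_slice_toBivariate]
      refine norm_eval_mul_le (fun x hx hroot => ?_) Polynomial.natDegree_map_le hz hζ
      refine hF ![x, r * w] (fun i => ?_) ((eval_slice_toBivariate F _ _).symm.trans hroot)
      fin_cases i
      · exact hx
      · show ‖(r : ℂ) * w‖ < 1
        rw [norm_mul, hw, mul_one, Complex.norm_real, Real.norm_of_nonneg hr.1.le]
        exact hr.2
    have h2 : ∀ x : ℂ, Tendsto (fun r : ℝ => ‖eval ![x, r * w] F‖) (𝓝[<] 1)
        (𝓝 ‖eval ![x, w] F‖) := by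
      intro x
      have hc : Continuous fun r : ℝ => ‖eval ![x, r * w] F‖ :=
        ((MvPolynomial.continuous_eval F).comp (continuous_pi fun i => by
          fin_cases i <;> simp <;> fun_prop)).norm
      have := (hc.tendsto 1).mono_left (nhdsWithin_le_nhds (s := Iio 1))
      simpa using this
    have h3 := le_of_tendsto_of_tendsto ((h2 ζ).mul_const _) ((h2 z).const_mul _) h1
    rw [← eval_slice_toBivariate F z, h.eq_zero, norm_zero, mul_zero] at h3
    have h4 : 0 < (1 - ‖z‖) ^ N := pow_pos (by linarith) _
    have h5 : ‖eval ![ζ, w] F‖ ≤ 0 := by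
      by_contra! h5
      linarith [mul_pos h5 h4]
    rw [Polynomial.IsRoot, eval_slice_toBivariate]
    exact norm_le_zero_iff.1 h5
  refine Polynomial.eq_zero_of_infinite_isRoot _ (Set.Infinite.mono (s := Metric.ball 0 1) ?_ ?_)
  · exact fun ζ hζ => key ζ (by simpa using hζ)
  · exact infinite_of_mem_nhds (0 : ℂ) (Metric.ball_mem_nhds _ one_pos)

/-- Reflecting `e^{iα} p̃ - p` in the bidegree of `p` exchanges its two terms up to a unimodular
constant, and `w` is fixed by inversion in the circle. -/
theorem NormalizedRIF.eval_levelPoly_reflect (φ : NormalizedRIF) {z w : ℂ} (hz : z ≠ 0)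
    (hw : ‖w‖ = 1) (h : eval ![z, w] φ.levelPoly = 0) :
    eval ![1 / starRingEnd ℂ z, w] φ.levelPoly = 0 := by
  have hw0 : w ≠ 0 := by rintro rfl; simp at hw
  have hcz : starRingEnd ℂ z ≠ 0 := (map_ne_zero _).2 hz
  have hww : w * starRingEnd ℂ w = 1 := by
    rw [Complex.mul_conj, Complex.normSq_eq_norm_sq, hw]; simp
  have hcw : 1 / starRingEnd ℂ w = w := by
    rw [div_eq_iff ((map_ne_zero _).2 hw0), hww]
  set c := Complex.exp (φ.angle * Complex.I) with hc
  have hcc : c * starRingEnd ℂ c = 1 := by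
    rw [Complex.mul_conj, Complex.normSq_eq_norm_sq, φ.norm_phase]; simp
  have e1 := eval_reflection φ.den ![z, w] (by intro i; fin_cases i; exacts [hz, hw0])
  have e2 := eval_reflection φ.den ![1 / starRingEnd ℂ z, w]
    (by intro i; fin_cases i; exacts [one_div_ne_zero hcz, hw0])
  have p1 : (fun i => 1 / starRingEnd ℂ ((![z, w] : C2) i)) = ![1 / starRingEnd ℂ z, w] := by
    ext i; fin_cases i
    · rfl
    · exact hcw
  have p2 : (fun i => 1 / starRingEnd ℂ ((![1 / starRingEnd ℂ z, w] : C2) i)) = ![z, w] := by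
    ext i; fin_cases i
    · simp
    · exact hcw
  rw [p1] at e1
  rw [p2] at e2
  rw [φ.eval_levelPoly, sub_eq_zero] at h ⊢
  simp only [Matrix.cons_val_zero, Matrix.cons_val_one] at e1 e2
  have e1' := congrArg (starRingEnd ℂ) e1
  simp only [map_mul, map_pow, Complex.conj_conj] at e1'
  rw [e2, ← h, map_mul, e1', ← hc]
  have h1 : (1 / starRingEnd ℂ z) ^ φ.den.degreeOf 0 * starRingEnd ℂ z ^ φ.den.degreeOf 0 = 1 := by
    rw [← mul_pow, one_div_mul_cancel hcz, one_pow]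
  have h2 : w ^ φ.den.degreeOf 1 * starRingEnd ℂ w ^ φ.den.degreeOf 1 = 1 := by
    rw [← mul_pow, hww, one_pow]
  linear_combination (eval ![1 / starRingEnd ℂ z, w] φ.den) *
    (hcc * ((1 / starRingEnd ℂ z) ^ φ.den.degreeOf 0 * starRingEnd ℂ z ^ φ.den.degreeOf 0) *
      (w ^ φ.den.degreeOf 1 * starRingEnd ℂ w ^ φ.den.degreeOf 1) +
      h1 * (w ^ φ.den.degreeOf 1 * starRingEnd ℂ w ^ φ.den.degreeOf 1) + h2)

theorem NormalizedRIF.slice_levelPoly (φ : NormalizedRIF) (hφ : ∃ z ∈ bidisk, φ.toFun z ≠ 1) {w : ℂ}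
    (hw : ‖w‖ = 1) {z : ℂ} (h : (slice (toBivariate φ.levelPoly) w).IsRoot z) :
    ‖z‖ = 1 ∨ slice (toBivariate φ.levelPoly) w = 0 := by
  have hF : ∀ z ∈ bidisk, eval z φ.levelPoly ≠ 0 := fun z hz h0 =>
    φ.toFun_ne_one hφ hz ((φ.eval_levelPoly_eq_zero_iff hz).1 h0)
  rcases lt_trichotomy ‖z‖ 1 with h1 | h1 | h1
  · exact Or.inr (slice_eq_zero_of_root hF h1 hw h)
  · exact Or.inl h1
  · have hz0 : z ≠ 0 := by rintro rfl; norm_num at h1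
    refine Or.inr (slice_eq_zero_of_root hF (z := 1 / starRingEnd ℂ z) ?_ hw ?_)
    · rw [norm_div, norm_one, Complex.norm_conj]
      exact (div_lt_one (by linarith)).2 h1
    · rw [Polynomial.IsRoot, eval_slice_toBivariate] at h ⊢
      exact φ.eval_levelPoly_reflect hz0 hw h

theorem NormalizedRIF.Gamma_inter_torus (φ : NormalizedRIF) : φ.twistedMap.Gamma ∩ torus =
    {z | z ∈ torus ∧ (slice (toBivariate φ.levelPoly) (z 1)).IsRoot (z 0)} := by
  ext z
  have h1 : φ.twistedMap.fixedPointPoly 0 = X 0 * φ.levelPoly := by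
    simp [RationalMap.fixedPointPoly, twistedMap, levelPoly, mul_sub]
  have h2 : φ.twistedMap.fixedPointPoly 1 = 0 := by
    simp [RationalMap.fixedPointPoly, twistedMap]
  have h3 : (slice (toBivariate φ.levelPoly) (z 1)).IsRoot (z 0) ↔ eval z φ.levelPoly = 0 := by
    rw [Polynomial.IsRoot, eval_slice_toBivariate, ← eq_cons_cons]
  have h4 : z ∈ φ.twistedMap.Gamma ↔ eval z (X 0 * φ.levelPoly) = 0 ∧ z ∈ closedBidisk := by
    rw [← h1]
    show (eval z _ = 0 ∧ eval z _ = 0) ∧ _ ↔ _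
    rw [h2]
    simp
  show z ∈ φ.twistedMap.Gamma ∧ z ∈ torus ↔ z ∈ torus ∧ _
  rw [h3, h4, map_mul, eval_X, mul_eq_zero]
  constructor
  · rintro ⟨⟨h5, -⟩, h6⟩
    refine ⟨h6, h5.resolve_left fun h0 => ?_⟩
    have := h6 0
    rw [h0] at this
    simp at this
  · rintro ⟨h5, h6⟩
    exact ⟨⟨Or.inr h6, fun i => (h5 i).le⟩, h5⟩

end RIF

end

theorem mainTheorem4 (φ : RIF.NormalizedRIF)
    (hφ : ∃ z ∈ RIF.bidisk, φ.toFun z ≠ 1) :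
    ∃ 𝒞 : Set (Set RIF.C2), 𝒞.Finite ∧
      φ.twistedMap.Gamma ∩ RIF.torus = ⋃₀ 𝒞 ∧
      (∀ K ∈ 𝒞, RIF.IsClosedAnalyticGraph K ∨ RIF.IsTorusFiber K) ∧
      (∀ K ∈ 𝒞, ∀ L ∈ 𝒞, K ≠ L → (K ∩ L).Finite) := by
  rw [φ.Gamma_inter_torus]
  refine RIF.exists_curve_decomposition ?_ fun w hw z hz => φ.slice_levelPoly hφ hw hz
  -- If the polynomial were zero, `φ` would equal `1` at the point where it is assumed not to.
  intro h0
  obtain ⟨z, hz, h1⟩ := hφ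
  refine h1 ((φ.eval_levelPoly_eq_zero_iff hz).1 ?_)
  rw [RIF.eq_cons_cons z, ← RIF.eval_slice_toBivariate, h0]
  simp [RIF.slice]
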